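/- Let $H_0=\begin{pmatrix}a_0&b_0\\c_0&d_0\end{pmatrix}$ and $H_1=\begin{pmatrix}a_1&b_1\\c_1&d_1\end{pmatrix}$ be real orthogonal matrices all of whose entries are non-zero, and let $\alpha,\beta\in\mathbb{C}$ with $|\alpha|^2+|\beta|^2=1$. For $t=0,1,2,\ldots$ let $U_t=H_0$ if $t$ is even and $U_t=H_1$ if $t$ is odd; let $P_t$ be $U_t$ with its second row replaced by zeros, and let $Q_t$ be $U_t$ with its first row replaced by zeros. Consider the quantum walk on $\mathbb{Z}$ with amplitudes $\psi_t(x)\in\mathbb{C}^2$ given by $\psi_0(0)={}^T[\alpha,\beta]$, $\psi_0(x)=0$ for $x\ne 0$, and $$\psi_{t+1}(x)=P_t\,\psi_t(x+1)+Q_t\,\psi_t(x-1),$$ and let $X_t$ be its position at time $t$, so that $P(X_t=x)=\|\psi_t(x)\|^2$ for $x\in\mathbb{Z}$. For $0<|a|<1$ let $$f_K(x;a)=\frac{\sqrt{1-|a|^2}}{\pi(1-x^2)\sqrt{|a|^2-x^2}}\,I_{(-|a|,|a|)}(x)$$ be the Konno density, where $I_A$ is the indicator function of $A$. Then, as $t\to\infty$,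 $X_t/t$ converges weakly (in distribution) to a random variable $Z$ with the probability density $$f(x)=f_K(x;a)\left[1-\left\{|\alpha|^2-|\beta|^2+\frac{(\alpha\overline{\beta}+\overline{\alpha}\beta)\,b_0}{a_0}\right\}x\right],$$ where (i) if $\det(H_1H_0)>0$, then $a\in\{a_0,a_1\}$ is such that $|a|=\min\{|a_0|,|a_1|\}$; (ii) if $\det(H_1H_0)<0$, then $a=a_0a_1$. -/

import Mathlib

open MeasureTheory Filter Topology ComplexConjugate

/-- The left-moving part `P` of a coin matrix: its first row is kept, its second row is zero. -/
def leftPart (U : Matrix (Fin 2) (Fin 2) ℂ) : Matrix (Fin 2) (Fin 2) ℂ :=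
  !![U 0 0, U 0 1; 0, 0]

/-- The right-moving part `Q` of a coin matrix: its second row is kept, its first row is zero. -/
def rightPart (U : Matrix (Fin 2) (Fin 2) ℂ) : Matrix (Fin 2) (Fin 2) ℂ :=
  !![0, 0; U 1 0, U 1 1]

/-- The amplitude `ψ_t(x) ∈ ℂ²` of the time-dependent quantum walk on `ℤ` with coin `U t` at
time `t`, started at the origin with coin state `(α, β)`. -/
def amplitude (U : ℕ → Matrix (Fin 2) (Fin 2) ℂ) (α β : ℂ) : ℕ → ℤ → (Fin 2 → ℂ)
  | 0, x => if x = 0 then ![α, β] else 0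
  | t + 1, x =>
      (leftPart (U t)).mulVec (amplitude U α β t (x + 1)) +
        (rightPart (U t)).mulVec (amplitude U α β t (x - 1))

/-- The probability `P(X_t = x) = ‖ψ_t(x)‖²` of finding the walker at `x` at time `t`. -/
noncomputable def positionProb (U : ℕ → Matrix (Fin 2) (Fin 2) ℂ) (α β : ℂ) (t : ℕ) (x : ℤ) : ℝ :=
  ∑ i : Fin 2, ‖amplitude U α β t x i‖ ^ 2

/-- The law of the position `X_t`, the measure on `ℤ` with point masses `P(X_t = x)`. -/
noncomputable def positionLaw (U : ℕ → Matrix (Fin 2) (Fin 2) ℂ) (α β : ℂ) (t : ℕ) : Measure ℤ :=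
  Measure.sum fun x : ℤ => ENNReal.ofReal (positionProb U α β t x) • Measure.dirac x

/-- The two-period coin sequence: `H₀` at even times, `H₁` at odd times. -/
noncomputable def twoPeriodCoin (H₀ H₁ : Matrix (Fin 2) (Fin 2) ℝ) (t : ℕ) :
    Matrix (Fin 2) (Fin 2) ℂ :=
  (if Even t then H₀ else H₁).map Complex.ofReal

/-- The Konno density `f_K(x; a)`. -/
noncomputable def konnoDensity (a x : ℝ) : ℝ :=
  (Set.Ioo (-|a|) |a|).indicator
    (fun y => √(1 - |a| ^ 2) / (Real.pi * (1 - y ^ 2) * √(|a| ^ 2 - y ^ 2))) x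

/-- The density `f_K(x; a) [1 - {|α|² - |β|² + (α β̄ + ᾱ β) b₀ / a₀} x]`.
The number `α β̄ + ᾱ β` is real, so taking its real part only changes its type. -/
noncomputable def limitDensity (a a₀ b₀ : ℝ) (α β : ℂ) (x : ℝ) : ℝ :=
  konnoDensity a x *
    (1 - (‖α‖ ^ 2 - ‖β‖ ^ 2 + (α * conj β + conj α * β).re * b₀ / a₀) * x)

/-- If `μ t` is the law of an integer-valued `X_t`, this says that `X_t / t` converges in
distribution to a real random variable with density `f`. It includes that every `μ t` is a
probability measure and that `f` is a probability density. -/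
def RescaledHasLimitDensity (μ : ℕ → Measure ℤ) (f : ℝ → ℝ) : Prop :=
  Measurable f ∧ (∀ x, 0 ≤ f x) ∧
    ∃ (_ : ∀ t, IsProbabilityMeasure (μ t))
      (_ : IsProbabilityMeasure ((volume : Measure ℝ).withDensity fun x => ENNReal.ofReal (f x))),
      TendstoInDistribution (fun (t : ℕ) (x : ℤ) => (x : ℝ) / (t : ℝ)) atTop (fun z : ℝ => z) μ
        ((volume : Measure ℝ).withDensity fun x => ENNReal.ofReal (f x))

/-!
The walk is translation invariant, so its amplitude is the inverse Fourier transform of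
`Ψ_t(k) = ∑ₓ e^{-ikx} ψ_t(x)`, and by Parseval the characteristic function of `X_t / t` at `ξ` is
the mean over `k` of the overlap `⟨Ψ_t(k), Ψ_t(k - ξ/t)⟩` (`charFun_map_positionLaw`). By Lévy's
continuity theorem it suffices to find the limit of these means.

Two steps of the walk multiply `Ψ` by a matrix which, up to a constant phase `e^{is}`, lies in
`SU(2)` and depends on `k` through `u = 2k - s` only (`momentumAmplitude_two_mul`). It has
eigenvalues `e^{±iθ(u)}` with `cos θ(u) = p cos u + q`, where `p = a₀ a₁`, and where
`q = ∓ b₀ b₁` if `det (H₁ H₀) > 0` and `q = 0` if `det (H₁ H₀) < 0`. Write it as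
`S = cos θ + i sin θ N` with `N` a Hermitian involution. In the overlap of `S(u)ⁿ φ` and
`S(u - 2ξ/t)ⁿ φ`, `n = ⌊t/2⌋`, all fast phases cancel and the limit is
`cos (ξ h) - i sin (ξ h) ⟨φ, N φ⟩` with `h = θ'` the group velocity (`tendsto_overlap_pow`).
Since `h` is odd in `u`, only the odd part of `⟨φ, N φ⟩` survives the mean over `u`, and this part
is `γ h` with `γ = |α|² - |β|² + 2 Re (α β̄) b₀ / a₀` (`spin_sub_spin_neg`). Dominated convergence
gives the limit, the mean over `u` of an even function of `h` (`tendsto_charFun_positionLaw`).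

It remains to find the law of `|h|` for uniform `u` (`map_abs_groupVelocity`). Put `|p| = A B` and
`|q| = √(1 - A²) √(1 - B²)` with `A ≤ B`. In a spherical triangle with sides `arcsin A`, `arcsin B`
enclosing the angle `u`, the third side is `θ(u)` and `h(u)` is the sine of the altitude on it. So
`|h| > x` holds exactly on the interval between the difference and the sum of the angles
`konnoAngle A x` and `konnoAngle B x` (`lt_abs_groupVelocity_iff`). Its length is twice the smaller
angle, which is the one belonging to `A`, and this is `π` times the two-sided tail of the Konno
density of parameter `A`. In the case of positive determinant `A` and `B` are the smaller and the
larger of `|a₀|`, `|a₁|`; in the case of negative determinant `A = |a₀ a₁|` and `B = 1`.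
-/

/-! ### The Konno density -/

/-- The group velocity `h(u) = θ'(u)` of the dispersion relation `cos θ(u) = p cos u + q`. -/
noncomputable def groupVelocity (p q u : ℝ) : ℝ :=
  p * Real.sin u / √(1 - (p * Real.cos u + q) ^ 2)

lemma measurable_konnoDensity (a : ℝ) : Measurable (konnoDensity a) := by
  unfold konnoDensity
  refine Measurable.indicator ?_ measurableSet_Ioo
  fun_prop

lemma konnoDensity_of_mem {a x : ℝ} (hx : x ∈ Set.Ioo (-|a|) |a|) :
    konnoDensity a x = √(1 - |a| ^ 2) / (Real.pi * (1 - x ^ 2) * √(|a| ^ 2 - x ^ 2)) := by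
  unfold konnoDensity
  rw [Set.indicator_of_mem hx]

lemma konnoDensity_of_notMem {a x : ℝ} (hx : x ∉ Set.Ioo (-|a|) |a|) :
    konnoDensity a x = 0 := by
  unfold konnoDensity
  rw [Set.indicator_of_notMem hx]

lemma konnoDensity_abs (a x : ℝ) : konnoDensity |a| x = konnoDensity a x := by
  simp [konnoDensity]

lemma konnoDensity_neg (a x : ℝ) : konnoDensity a (-x) = konnoDensity a x := by
  unfold konnoDensity
  by_cases h : x ∈ Set.Ioo (-|a|) |a|
  · have h' : -x ∈ Set.Ioo (-|a|) |a| := by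
      constructor <;> linarith [h.1, h.2]
    rw [Set.indicator_of_mem h, Set.indicator_of_mem h', neg_sq]
  · have h' : -x ∉ Set.Ioo (-|a|) |a| := by
      intro h'
      exact h (by constructor <;> linarith [h'.1, h'.2])
    rw [Set.indicator_of_notMem h, Set.indicator_of_notMem h']

lemma konnoDensity_nonneg {a : ℝ} (ha : |a| < 1) (x : ℝ) : 0 ≤ konnoDensity a x := by
  by_cases hx : x ∈ Set.Ioo (-|a|) |a|
  · rw [konnoDensity_of_mem hx]
    have : 0 ≤ 1 - x ^ 2 := by nlinarith [hx.1, hx.2]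
    have := Real.pi_pos
    positivity
  · rw [konnoDensity_of_notMem hx]

/-- `π` times the mass that the Konno density of parameter `A` puts to the right of `x`.
Geometrically: in a right spherical triangle with hypotenuse `arcsin A` and a leg `arcsin x`, the
angle between the two. -/
noncomputable def konnoAngle (A x : ℝ) : ℝ :=
  Real.arccos (√(1 - A ^ 2) * (x / √(1 - x ^ 2)) / A)

lemma konnoAngle_neg (A x : ℝ) : konnoAngle A (-x) = Real.pi - konnoAngle A x := by
  unfold konnoAngle
  rw [← Real.arccos_neg, neg_sq]
  ring_nf

lemma konnoAngle_self {A : ℝ} (h0 : 0 < A) (h1 : A < 1) : konnoAngle A A = 0 := by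
  unfold konnoAngle
  have : 0 < √(1 - A ^ 2) := Real.sqrt_pos.2 (by nlinarith)
  rw [show √(1 - A ^ 2) * (A / √(1 - A ^ 2)) / A = 1 by field_simp, Real.arccos_one]

lemma continuousOn_konnoAngle {A x : ℝ} (hx : x ^ 2 < 1) :
    ContinuousOn (konnoAngle A) (Set.Icc (-x) x) := by
  unfold konnoAngle
  refine Real.continuous_arccos.comp_continuousOn ?_
  refine ContinuousOn.div_const (continuousOn_const.mul ?_) _
  refine ContinuousOn.div continuousOn_id (by fun_prop) ?_
  intro y hy
  have : y ^ 2 < 1 := by nlinarith [hy.1, hy.2]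
  exact (Real.sqrt_pos.2 (by linarith)).ne'

lemma hasDerivAt_konnoAngle {A x : ℝ} (h0 : 0 < A) (h1 : A < 1) (hx : x ∈ Set.Ioo (-A) A) :
    HasDerivAt (konnoAngle A) (-(Real.pi * konnoDensity A x)) x := by
  have hx2 : x ^ 2 < A ^ 2 := by nlinarith [hx.1, hx.2]
  have hxs : 0 < 1 - x ^ 2 := by nlinarith
  have hAs : 0 < 1 - A ^ 2 := by nlinarith
  have hAx : 0 < A ^ 2 - x ^ 2 := by linarith
  set b := √(1 - A ^ 2) with hb
  set s := √(1 - x ^ 2) with hs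
  set r := √(A ^ 2 - x ^ 2) with hr
  have bpos : 0 < b := Real.sqrt_pos.2 hAs
  have spos : 0 < s := Real.sqrt_pos.2 hxs
  have rpos : 0 < r := Real.sqrt_pos.2 hAx
  have b2 : b ^ 2 = 1 - A ^ 2 := Real.sq_sqrt hAs.le
  have s2 : s ^ 2 = 1 - x ^ 2 := Real.sq_sqrt hxs.le
  have r2 : r ^ 2 = A ^ 2 - x ^ 2 := Real.sq_sqrt hAx.le
  have hd : HasDerivAt (fun y : ℝ => √(1 - y ^ 2)) (-x / s) x := by
    have := ((hasDerivAt_pow 2 x).const_sub 1).sqrt hxs.ne'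
    convert this using 1
    rw [← hs]; field_simp; ring
  have hd2 : HasDerivAt (fun y : ℝ => b * (y / √(1 - y ^ 2)) / A) (b / (A * s ^ 3)) x := by
    have := (((hasDerivAt_id x).div hd spos.ne').const_mul b).div_const A
    refine this.congr_deriv ?_
    rw [← hs]; simp only [id]; field_simp; linear_combination s2
  -- the argument `g` of `arccos` satisfies `1 - g² = (r / (A s))²`
  have hg : 1 - (b * (x / s) / A) ^ 2 = (r / (A * s)) ^ 2 := by
    field_simp
    rw [s2, b2, r2]; ring
  have hgpos : 0 < 1 - (b * (x / s) / A) ^ 2 := by rw [hg]; positivity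
  have hne1 : b * (x / s) / A ≠ -1 := by intro h; rw [h] at hgpos; norm_num at hgpos
  have hne2 : b * (x / s) / A ≠ 1 := by intro h; rw [h] at hgpos; norm_num at hgpos
  have h := (Real.hasDerivAt_arccos hne1 hne2).comp x hd2
  refine h.congr_deriv ?_
  rw [hg, Real.sqrt_sq (by positivity), konnoDensity_of_mem (by rwa [abs_of_pos h0]),
    abs_of_pos h0, ← hb, ← hr, ← s2]
  have := Real.pi_pos
  field_simp

/-- The mass of a symmetric interval under the Konno density. -/
lemma lintegral_konnoDensity_Icc {A x : ℝ} (h0 : 0 < A) (h1 : A < 1) (hx0 : 0 ≤ x) (hx : x ≤ A) :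
    ∫⁻ y in Set.Icc (-x) x, ENNReal.ofReal (konnoDensity A y) =
      ENNReal.ofReal (1 - 2 * konnoAngle A x / Real.pi) := by
  have hle : -x ≤ x := by linarith
  have hc : ContinuousOn (fun y => -(konnoAngle A y / Real.pi)) (Set.Icc (-x) x) :=
    ((continuousOn_konnoAngle (by nlinarith)).div_const _).neg
  have hd : ∀ y ∈ Set.Ioo (-x) x,
      HasDerivAt (fun y => -(konnoAngle A y / Real.pi)) (konnoDensity A y) y := by
    intro y hy
    have hy' : y ∈ Set.Ioo (-A) A := ⟨by linarith [hy.1], by linarith [hy.2]⟩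
    refine ((hasDerivAt_konnoAngle h0 h1 hy').div_const Real.pi).fun_neg.congr_deriv ?_
    field_simp
  have hnn := konnoDensity_nonneg (a := A) (by rwa [abs_of_pos h0])
  have hint := intervalIntegral.integrableOn_deriv_of_nonneg hc hd (fun y _ => hnn y)
  have hint' : IntervalIntegrable (konnoDensity A) volume (-x) x :=
    (intervalIntegrable_iff_integrableOn_Ioc_of_le hle).2 hint
  have key := intervalIntegral.integral_eq_sub_of_hasDerivAt_of_le hle hc hd hint'
  rw [← Measure.restrict_congr_set Ioc_ae_eq_Icc, ← ofReal_integral_eq_lintegral_ofReal hint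
    (Eventually.of_forall hnn), ← intervalIntegral.integral_of_le hle, key, konnoAngle_neg]
  congr 1
  field_simp
  ring

lemma setLIntegral_konnoDensity {A : ℝ} {s : Set ℝ} (hs : MeasurableSet s)
    (h : Set.Ioo (-|A|) |A| ⊆ s) :
    ∫⁻ y in s, ENNReal.ofReal (konnoDensity A y) = ∫⁻ y, ENNReal.ofReal (konnoDensity A y) := by
  rw [← lintegral_indicator hs]
  congr 1
  refine Set.indicator_eq_self.2 fun y hy => h ?_
  by_contra hy'
  exact hy (by simp only [konnoDensity_of_notMem hy', ENNReal.ofReal_zero])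

lemma lintegral_konnoDensity {A : ℝ} (h0 : 0 < A) (h1 : A < 1) :
    ∫⁻ y, ENNReal.ofReal (konnoDensity A y) = 1 := by
  rw [← setLIntegral_konnoDensity measurableSet_Icc
    (by rw [abs_of_pos h0]; exact Set.Ioo_subset_Icc_self),
    lintegral_konnoDensity_Icc h0 h1 h0.le le_rfl, konnoAngle_self h0 h1]
  simp

lemma withDensity_konnoDensity_Icc_of_ge {A x : ℝ} (h0 : 0 < A) (h1 : A < 1) (hx : A ≤ x) :
    (volume.withDensity fun y => ENNReal.ofReal (konnoDensity A y)) (Set.Icc (-x) x) = 1 := by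
  rw [withDensity_apply _ measurableSet_Icc, setLIntegral_konnoDensity measurableSet_Icc ?_,
    lintegral_konnoDensity h0 h1]
  rw [abs_of_pos h0]
  exact Set.Ioo_subset_Icc_self.trans (Set.Icc_subset_Icc (by linarith) hx)

/-! ### The law of the group velocity -/

/-- The dispersion relation degenerates at most where `sin u = 0`. -/
lemma sq_add_mul_cos_lt_one {p q u : ℝ} (hp : p ≠ 0) (hpq : |p| + |q| ≤ 1)
    (hu : Real.sin u ≠ 0) : (p * Real.cos u + q) ^ 2 < 1 := by
  have hc : |Real.cos u| < 1 := by
    rw [← sq_lt_one_iff_abs_lt_one]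
    have := Real.sin_sq_add_cos_sq u
    have := pow_pos (abs_pos.2 hu) 2
    rw [sq_abs] at this
    linarith
  rw [sq_lt_one_iff_abs_lt_one]
  calc |p * Real.cos u + q| ≤ |p * Real.cos u| + |q| := abs_add_le _ _
    _ = |p| * |Real.cos u| + |q| := by rw [abs_mul]
    _ < |p| * 1 + |q| := by
        have := mul_lt_mul_of_pos_left hc (abs_pos.2 hp)
        linarith
    _ ≤ 1 := by linarith

lemma measurable_groupVelocity (p q : ℝ) : Measurable (groupVelocity p q) := by
  unfold groupVelocity
  fun_prop

lemma groupVelocity_sq {p q u : ℝ} (hD : (p * Real.cos u + q) ^ 2 < 1) :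
    groupVelocity p q u ^ 2 =
      p ^ 2 * Real.sin u ^ 2 / (1 - (p * Real.cos u + q) ^ 2) := by
  unfold groupVelocity
  rw [div_pow, mul_pow, Real.sq_sqrt (by linarith)]

lemma abs_groupVelocity_le {A B a' b' u : ℝ} (hA : 0 < A)
    (ha' : A ^ 2 + a' ^ 2 = 1) (hb' : B ^ 2 + b' ^ 2 = 1)
    (hD : (A * B * Real.cos u + a' * b') ^ 2 < 1) :
    |groupVelocity (A * B) (a' * b') u| ≤ A := by
  refine abs_le_of_sq_le_sq ?_ hA.le
  rw [groupVelocity_sq hD, div_le_iff₀ (by linarith)]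
  have hs := Real.sin_sq_add_cos_sq u
  set y := Real.cos u
  have hs' : Real.sin u ^ 2 = 1 - y ^ 2 := by linarith
  -- the difference of the two sides is `A² (A b' - B a' y)²`
  have : A ^ 2 * (1 - (A * B * y + a' * b') ^ 2) - (A * B) ^ 2 * (1 - y ^ 2) =
      A ^ 2 * (A * b' - B * a' * y) ^ 2 := by
    have e1 : a' ^ 2 = 1 - A ^ 2 := by linarith
    have e2 : B ^ 2 = 1 - b' ^ 2 := by linarith
    linear_combination (A ^ 2 * (- b' ^ 2 - B ^ 2 * y ^ 2)) * e1 + (-A ^ 2) * e2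
  rw [hs']
  nlinarith [mul_nonneg (sq_nonneg A) (sq_nonneg (A * b' - B * a' * y))]

/-- The superlevel sets of the group velocity are intervals. In a spherical triangle with sides
`arcsin A`, `arcsin B` enclosing the angle `u`, the group velocity is the sine of the altitude on
the third side, and this altitude splits (or extends) `u` into the two angles `konnoAngle`. -/
lemma lt_abs_groupVelocity_iff {A B x u : ℝ} (hA : 0 < A) (hA1 : A < 1) (hAB : A ≤ B) (hB1 : B ≤ 1)
    (hx0 : 0 ≤ x) (hx : x < A) (hu : u ∈ Set.Ioo 0 Real.pi)
    (hD : (A * B * Real.cos u + √(1 - A ^ 2) * √(1 - B ^ 2)) ^ 2 < 1) :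
    x < |groupVelocity (A * B) (√(1 - A ^ 2) * √(1 - B ^ 2)) u| ↔
      u ∈ Set.Ioo (konnoAngle B x - konnoAngle A x) (konnoAngle B x + konnoAngle A x) := by
  have hB : 0 < B := hA.trans_le hAB
  have hxs : 0 < 1 - x ^ 2 := by nlinarith
  set a' := √(1 - A ^ 2) with ha'
  set b' := √(1 - B ^ 2) with hb'
  set s := √(1 - x ^ 2) with hs
  have spos : 0 < s := Real.sqrt_pos.2 hxs
  have s2 : s ^ 2 = 1 - x ^ 2 := Real.sq_sqrt hxs.le
  have a2 : a' ^ 2 = 1 - A ^ 2 := Real.sq_sqrt (by nlinarith)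
  have b2 : b' ^ 2 = 1 - B ^ 2 := Real.sq_sqrt (by nlinarith)
  have a0 : 0 ≤ a' := Real.sqrt_nonneg _
  have b0 : 0 ≤ b' := Real.sqrt_nonneg _
  set C := a' * (x / s) / A with hC
  set E := b' * (x / s) / B with hE
  have hba : b' ≤ a' := Real.sqrt_le_sqrt (by nlinarith)
  have hC0 : 0 ≤ C := by positivity
  have hE0 : 0 ≤ E := by positivity
  have hEC : E ≤ C := by
    rw [hC, hE]; gcongr
  have hC1 : C ≤ 1 := by
    rw [hC, div_le_one hA, mul_div_assoc', div_le_iff₀ spos]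
    refine abs_le_of_sq_le_sq' ?_ (by positivity) |>.2
    rw [mul_pow, mul_pow, a2, s2]; nlinarith
  have hE1 : E ≤ 1 := hEC.trans hC1
  have hcC : Real.cos (konnoAngle A x) = C := Real.cos_arccos (by linarith) hC1
  have hcE : Real.cos (konnoAngle B x) = E := Real.cos_arccos (by linarith) hE1
  have hA0 : 0 ≤ konnoAngle A x := Real.arccos_nonneg _
  have hA2 : konnoAngle A x ≤ Real.pi / 2 := Real.arccos_le_pi_div_two.2 hC0
  have hB2 : konnoAngle B x ≤ Real.pi / 2 := Real.arccos_le_pi_div_two.2 hE0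
  have hle : konnoAngle A x ≤ konnoAngle B x := Real.arccos_le_arccos hEC
  set φ := konnoAngle A x
  set χ := konnoAngle B x
  have hsφ : 0 ≤ Real.sin φ := Real.sin_nonneg_of_nonneg_of_le_pi hA0 (by linarith [Real.pi_pos])
  have hsχ : 0 ≤ Real.sin χ :=
    Real.sin_nonneg_of_nonneg_of_le_pi (by linarith) (by linarith [Real.pi_pos])
  have hpy := Real.sin_sq_add_cos_sq u
  have hpφ := Real.sin_sq_add_cos_sq φ
  have hpχ := Real.sin_sq_add_cos_sq χ
  have hs' : Real.sin u ^ 2 = 1 - Real.cos u ^ 2 := by linarith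
  have hiff1 : x < |groupVelocity (A * B) (a' * b') u| ↔
      (Real.cos u - C * E) ^ 2 < (Real.sin χ * Real.sin φ) ^ 2 := by
    rw [show x < |groupVelocity (A * B) (a' * b') u| ↔ |x| < |groupVelocity (A * B) (a' * b') u| by
      rw [abs_of_nonneg hx0], ← sq_lt_sq, groupVelocity_sq hD, lt_div_iff₀ (by linarith),
      ← sub_pos, ← sub_pos (a := (Real.sin χ * Real.sin φ) ^ 2)]
    have hfac : (A * B) ^ 2 * Real.sin u ^ 2 -
        x ^ 2 * (1 - (A * B * Real.cos u + a' * b') ^ 2) =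
        (A * B * s) ^ 2 * ((Real.sin χ * Real.sin φ) ^ 2 - (Real.cos u - C * E) ^ 2) := by
      have e1 : Real.sin φ ^ 2 = 1 - C ^ 2 := by rw [← hcC]; linarith
      have e2 : Real.sin χ ^ 2 = 1 - E ^ 2 := by rw [← hcE]; linarith
      have k1 : A * s * C = a' * x := by rw [hC]; field_simp
      have k2 : B * s * E = b' * x := by rw [hE]; field_simp
      have k3 : (A * B * s) ^ 2 * (C * E) = A * B * (a' * x) * (b' * x) := by
        rw [← k1, ← k2]; ring
      have k4 : (A * B * s) ^ 2 * C ^ 2 = B ^ 2 * (a' * x) ^ 2 := by rw [← k1]; ring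
      have k5 : (A * B * s) ^ 2 * E ^ 2 = A ^ 2 * (b' * x) ^ 2 := by rw [← k2]; ring
      rw [mul_pow (Real.sin χ), e1, e2, hs']
      have : (A * B * s) ^ 2 * ((1 - E ^ 2) * (1 - C ^ 2) - (Real.cos u - C * E) ^ 2) =
          A ^ 2 * B ^ 2 * s ^ 2 * (1 - Real.cos u ^ 2) - B ^ 2 * (a' * x) ^ 2
            - A ^ 2 * (b' * x) ^ 2 + 2 * (A * B * (a' * x) * (b' * x)) * Real.cos u := by
        rw [← k3, ← k4, ← k5]; ring
      rw [this, s2]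
      have e3 : A ^ 2 = 1 - a' ^ 2 := by linarith
      have e4 : B ^ 2 = 1 - b' ^ 2 := by linarith
      ring_nf
      rw [e3, e4]
      ring
    rw [hfac]
    have : 0 < (A * B * s) ^ 2 := by positivity
    exact mul_pos_iff_of_pos_left this
  rw [hiff1, sq_lt_sq, abs_of_nonneg (mul_nonneg hsχ hsφ), abs_lt]
  have c1 : Real.cos (χ + φ) = C * E - Real.sin χ * Real.sin φ := by
    rw [Real.cos_add, hcC, hcE]; ring
  have c2 : Real.cos (χ - φ) = C * E + Real.sin χ * Real.sin φ := by
    rw [Real.cos_sub, hcC, hcE]; ring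
  have i1 : Real.cos (χ + φ) < Real.cos u ↔ u < χ + φ :=
    Real.strictAntiOn_cos.lt_iff_gt ⟨by linarith, by linarith⟩ (Set.Ioo_subset_Icc_self hu)
  have i2 : Real.cos u < Real.cos (χ - φ) ↔ χ - φ < u :=
    Real.strictAntiOn_cos.lt_iff_gt (Set.Ioo_subset_Icc_self hu) ⟨by linarith, by linarith⟩
  rw [Set.mem_Ioo, ← i1, ← i2, c1, c2]
  constructor
  · rintro ⟨h1, h2⟩; constructor <;> linarith
  · rintro ⟨h1, h2⟩; constructor <;> linarith

/-- For `u` uniform on `(0, π)` the speed `|h(u)|` has the law of `|Y|`, where `Y` has the Konno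
density of parameter `A`; the larger parameter `B` does not matter. -/
lemma map_abs_groupVelocity {A B : ℝ} (hA : 0 < A) (hA1 : A < 1) (hAB : A ≤ B) (hB1 : B ≤ 1) :
    (volume.restrict (Set.Ioo 0 Real.pi)).map
        (fun u => |groupVelocity (A * B) (√(1 - A ^ 2) * √(1 - B ^ 2)) u|) =
      ENNReal.ofReal Real.pi •
        (volume.withDensity fun y => ENNReal.ofReal (konnoDensity A y)).map (fun y => |y|) := by
  have hB : 0 < B := hA.trans_le hAB
  have hπ := Real.pi_pos
  have a2 : √(1 - A ^ 2) ^ 2 = 1 - A ^ 2 := Real.sq_sqrt (by nlinarith)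
  have b2 : √(1 - B ^ 2) ^ 2 = 1 - B ^ 2 := Real.sq_sqrt (by nlinarith)
  have hD : ∀ u ∈ Set.Ioo 0 Real.pi,
      (A * B * Real.cos u + √(1 - A ^ 2) * √(1 - B ^ 2)) ^ 2 < 1 := by
    intro u hu
    refine sq_add_mul_cos_lt_one (by positivity) ?_ (Real.sin_pos_of_pos_of_lt_pi hu.1 hu.2).ne'
    rw [abs_of_pos (by positivity), abs_of_nonneg (by positivity)]
    nlinarith [sq_nonneg (A - B), sq_nonneg (√(1 - A ^ 2) - √(1 - B ^ 2))]
  have hm : Measurable (fun u => |groupVelocity (A * B) (√(1 - A ^ 2) * √(1 - B ^ 2)) u|) :=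
    (measurable_groupVelocity _ _).abs
  refine Measure.ext_of_Iic _ _ fun x => ?_
  rw [Measure.map_apply hm measurableSet_Iic, Measure.smul_apply,
    Measure.map_apply (f := fun y : ℝ => |y|) measurable_id.abs measurableSet_Iic,
    Measure.restrict_apply (hm measurableSet_Iic), smul_eq_mul]
  rcases lt_or_ge x 0 with hx0 | hx0
  · have e1 : (fun u => |groupVelocity (A * B) (√(1 - A ^ 2) * √(1 - B ^ 2)) u|) ⁻¹' Set.Iic x
        = ∅ := by
      ext u
      simp only [Set.mem_preimage, Set.mem_Iic, Set.mem_empty_iff_false, iff_false, not_le]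
      exact hx0.trans_le (abs_nonneg _)
    have e2 : (fun y : ℝ => |y|) ⁻¹' Set.Iic x = ∅ := by
      ext u
      simp only [Set.mem_preimage, Set.mem_Iic, Set.mem_empty_iff_false, iff_false, not_le]
      exact hx0.trans_le (abs_nonneg _)
    rw [e1, e2]; simp
  have e2 : (fun y : ℝ => |y|) ⁻¹' Set.Iic x = Set.Icc (-x) x := by
    ext u; simp [abs_le]
  rw [e2]
  rcases le_or_gt A x with hx | hx
  · rw [withDensity_konnoDensity_Icc_of_ge hA hA1 hx, mul_one, Set.inter_eq_right.2,
      Real.volume_Ioo, sub_zero]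
    intro u hu
    exact (abs_groupVelocity_le hA (by linarith) (by linarith) (hD u hu)).trans hx
  · rw [withDensity_apply _ measurableSet_Icc, lintegral_konnoDensity_Icc hA hA1 hx0 hx.le,
      ← ENNReal.ofReal_mul hπ.le]
    have e3 : (fun u => |groupVelocity (A * B) (√(1 - A ^ 2) * √(1 - B ^ 2)) u|) ⁻¹' Set.Iic x ∩
        Set.Ioo 0 Real.pi = Set.Ioo 0 Real.pi \
          Set.Ioo (konnoAngle B x - konnoAngle A x) (konnoAngle B x + konnoAngle A x) := by
      ext u
      simp only [Set.mem_inter_iff, Set.mem_preimage, Set.mem_Iic, Set.mem_sdiff]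
      rw [and_comm]
      refine and_congr_right fun hu => ?_
      rw [← lt_abs_groupVelocity_iff hA hA1 hAB hB1 hx0 hx hu (hD u hu), not_lt]
    have hx' : 0 ≤ x / √(1 - x ^ 2) := by positivity
    have h1 : konnoAngle A x ≤ konnoAngle B x := by
      refine Real.arccos_le_arccos ?_
      have : √(1 - B ^ 2) ≤ √(1 - A ^ 2) := Real.sqrt_le_sqrt (by nlinarith)
      gcongr
    have h2 : konnoAngle B x ≤ Real.pi / 2 := Real.arccos_le_pi_div_two.2 (by positivity)
    have h3 : 0 ≤ konnoAngle A x := Real.arccos_nonneg _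
    rw [e3, measure_sdiff (Set.Ioo_subset_Ioo (by linarith) (by linarith))
      measurableSet_Ioo.nullMeasurableSet (by simp), Real.volume_Ioo, Real.volume_Ioo,
      ← ENNReal.ofReal_sub _ (by linarith)]
    congr 1
    field_simp
    ring

lemma groupVelocity_neg (p q u : ℝ) : groupVelocity p q (-u) = -groupVelocity p q u := by
  simp [groupVelocity, neg_div]

lemma abs_groupVelocity_le_one {p q : ℝ} (hpq : |p| + |q| ≤ 1) (u : ℝ) :
    |groupVelocity p q u| ≤ 1 := by
  unfold groupVelocity
  rw [abs_div, abs_of_nonneg (Real.sqrt_nonneg _)]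
  refine div_le_one_of_le₀ ?_ (Real.sqrt_nonneg _)
  refine Real.le_sqrt_of_sq_le ?_
  rw [sq_abs, mul_pow, Real.sin_sq]
  have h1 : 2 * (p * q * Real.cos u) ≤ 2 * (|p| * |q|) := by
    have := mul_le_mul_of_nonneg_left (Real.abs_cos_le_one u) (abs_nonneg (p * q))
    rw [mul_one, ← abs_mul, abs_mul p] at this
    linarith [le_abs_self (p * q * Real.cos u)]
  have h2 : (|p| + |q|) ^ 2 ≤ 1 := by
    have := abs_nonneg p; have := abs_nonneg q; nlinarith
  nlinarith [sq_abs p, sq_abs q]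

/-- Composing a continuous function with the group velocity gives a bounded function. -/
lemma intervalIntegrable_comp_groupVelocity {p q : ℝ} (hpq : |p| + |q| ≤ 1) {G : ℝ → ℂ}
    (hG : Continuous G) (a b : ℝ) :
    IntervalIntegrable (fun u => G (groupVelocity p q u)) volume a b := by
  obtain ⟨C, hC⟩ := (isCompact_Icc (a := (-1 : ℝ)) (b := 1)).exists_bound_of_continuousOn
    hG.continuousOn
  rw [intervalIntegrable_iff]
  refine Measure.integrableOn_of_bounded (M := C) (by simp) ?_ (Eventually.of_forall fun u => ?_)
  · exact (hG.measurable.comp (measurable_groupVelocity p q)).aestronglyMeasurable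
  · exact hC _ (abs_le.1 (abs_groupVelocity_le_one hpq u))

lemma integral_abs_groupVelocity_half {A B : ℝ} (hA : 0 < A) (hA1 : A < 1) (hAB : A ≤ B)
    (hB1 : B ≤ 1) {G : ℝ → ℂ} (hG : Continuous G) :
    ∫ u in 0..Real.pi, G |groupVelocity (A * B) (√(1 - A ^ 2) * √(1 - B ^ 2)) u| =
      Real.pi * ∫ y, konnoDensity A y • G |y| := by
  have hm : Measurable (fun u => |groupVelocity (A * B) (√(1 - A ^ 2) * √(1 - B ^ 2)) u|) :=
    (measurable_groupVelocity _ _).abs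
  have habs : Measurable (fun y : ℝ => |y|) := measurable_id.abs
  rw [intervalIntegral.integral_of_le Real.pi_pos.le, integral_Ioc_eq_integral_Ioo,
    ← integral_map (μ := volume.restrict (Set.Ioo 0 Real.pi)) (f := G) hm.aemeasurable
      hG.aestronglyMeasurable,
    map_abs_groupVelocity hA hA1 hAB hB1, integral_smul_measure,
    integral_map (f := G) habs.aemeasurable hG.aestronglyMeasurable,
    integral_withDensity_eq_integral_toReal_smul
      (measurable_konnoDensity A).ennreal_ofReal (by simp),
    ENNReal.toReal_ofReal Real.pi_pos.le, Complex.real_smul]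
  congr 1
  refine integral_congr_ae (Eventually.of_forall fun y => ?_)
  simp only [ENNReal.toReal_ofReal (konnoDensity_nonneg (by rwa [abs_of_pos hA]) y)]

/-- For `u` uniform on the circle, even functions of the group velocity have the same mean as for
a Konno-distributed variable, whatever the signs of `p` and `q`. -/
lemma integral_abs_groupVelocity {A B p q : ℝ} (hA : 0 < A) (hA1 : A < 1) (hAB : A ≤ B)
    (hB1 : B ≤ 1) (hp : |p| = A * B) (hq : |q| = √(1 - A ^ 2) * √(1 - B ^ 2))
    (hpq : |p| + |q| ≤ 1) {G : ℝ → ℂ} (hG : Continuous G) :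
    ∫ u in 0..2 * Real.pi, G |groupVelocity p q u| =
      2 * Real.pi * ∫ y, konnoDensity A y • G |y| := by
  have hint := fun a b => intervalIntegrable_comp_groupVelocity hpq (G := fun y => G |y|)
    (hG.comp continuous_abs) a b
  have hrefl : ∫ u in Real.pi..2 * Real.pi, G |groupVelocity p q u| =
      ∫ u in 0..Real.pi, G |groupVelocity p q u| := by
    have := intervalIntegral.integral_comp_sub_left (a := 0) (b := Real.pi)
      (fun u => G |groupVelocity p q u|) (2 * Real.pi)
    rw [sub_zero, show 2 * Real.pi - Real.pi = Real.pi by ring] at this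
    rw [← this]
    refine intervalIntegral.integral_congr fun u _ => ?_
    simp only [groupVelocity, Real.sin_two_pi_sub, Real.cos_two_pi_sub, mul_neg, neg_div, abs_neg]
  have hhalf : ∫ u in 0..Real.pi, G |groupVelocity p q u| =
      ∫ u in 0..Real.pi, G |groupVelocity |p| (|q|) u| := by
    -- only the sign of `p q` matters, and `u ↦ π - u` reverses it
    by_cases hs : 0 ≤ p * q
    · refine intervalIntegral.integral_congr fun u _ => ?_
      have : (p * Real.cos u + q) ^ 2 = (|p| * Real.cos u + |q|) ^ 2 := by
        have : |p| * |q| = p * q := by rw [← abs_mul, abs_of_nonneg hs]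
        linear_combination - Real.cos u ^ 2 * sq_abs p - sq_abs q
          - 2 * Real.cos u * this
      simp only [groupVelocity, this, abs_div, abs_mul, abs_abs]
    · have := intervalIntegral.integral_comp_sub_left (a := 0) (b := Real.pi)
        (fun u => G |groupVelocity p q u|) Real.pi
      rw [sub_zero, sub_self] at this
      rw [← this]
      refine intervalIntegral.integral_congr fun u _ => ?_
      have : (p * -Real.cos u + q) ^ 2 = (|p| * Real.cos u + |q|) ^ 2 := by
        have : |p| * |q| = -(p * q) := by rw [← abs_mul, abs_of_neg (not_le.1 hs)]
        linear_combination - Real.cos u ^ 2 * sq_abs p - sq_abs q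
          - 2 * Real.cos u * this
      simp only [groupVelocity, Real.sin_pi_sub, Real.cos_pi_sub, this, abs_div, abs_mul, abs_abs]
  rw [← intervalIntegral.integral_add_adjacent_intervals (hint 0 Real.pi)
    (hint Real.pi (2 * Real.pi)), hrefl, hhalf, hp, hq,
    integral_abs_groupVelocity_half hA hA1 hAB hB1 hG]
  ring

/-! ### Parseval and the walk in momentum space -/

/-- The shift in momentum space: the Fourier multiplier `diag(e^{ik}, e^{-ik})`. -/
noncomputable def shiftMatrix (k : ℝ) : Matrix (Fin 2) (Fin 2) ℂ :=
  !![Complex.exp (k * Complex.I), 0; 0, Complex.exp (-(k * Complex.I))]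

/-- The amplitude in momentum space, `Ψ_t(k) = ∑ₓ e^{-ikx} ψ_t(x)`, defined by its recursion. -/
noncomputable def momentumAmplitude (U : ℕ → Matrix (Fin 2) (Fin 2) ℂ) (α β : ℂ) :
    ℕ → ℝ → (Fin 2 → ℂ)
  | 0, _ => ![α, β]
  | t + 1, k => (shiftMatrix k).mulVec ((U t).mulVec (momentumAmplitude U α β t k))

/-- The momentum amplitude is the Fourier transform of the position amplitude. -/
lemma hasSum_momentumAmplitude (U : ℕ → Matrix (Fin 2) (Fin 2) ℂ) (α β : ℂ) (t : ℕ) (k : ℝ)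
    (i : Fin 2) :
    HasSum (fun x : ℤ => Complex.exp (-(k * x * Complex.I)) * amplitude U α β t x i)
      (momentumAmplitude U α β t k i) := by
  induction t generalizing i with
  | zero =>
    convert! hasSum_ite_eq (0 : ℤ) (![α, β] i) using 2 with x
    by_cases hx : x = 0 <;> simp [amplitude, hx]
  | succ t ih =>
    have hs : ∀ (y : ℤ) (j : Fin 2), HasSum (fun x : ℤ =>
        Complex.exp (-(k * (x + y : ℤ) * Complex.I)) * amplitude U α β t (x + y) j)
        (momentumAmplitude U α β t k j) := fun y j =>
      (Equiv.hasSum_iff (Equiv.addRight y) (f := fun x : ℤ =>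
        Complex.exp (-(k * x * Complex.I)) * amplitude U α β t x j)).2 (ih j)
    fin_cases i
    · convert! (((hs 1 0).mul_left (U t 0 0)).add ((hs 1 1).mul_left (U t 0 1))).mul_left
        (Complex.exp (k * Complex.I)) using 1
      · funext x
        have : Complex.exp (-(k * x * Complex.I)) = Complex.exp (k * Complex.I) *
            Complex.exp (-(k * (x + 1 : ℤ) * Complex.I)) := by
          rw [← Complex.exp_add]; push_cast; ring_nf
        simp [amplitude, leftPart, rightPart, dotProduct, this]
        ring
      · simp [momentumAmplitude, shiftMatrix, Matrix.mulVec, dotProduct]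
    · convert! (((hs (-1) 0).mul_left (U t 1 0)).add ((hs (-1) 1).mul_left (U t 1 1))).mul_left
        (Complex.exp (-(k * Complex.I))) using 1
      · funext x
        have : Complex.exp (-(k * x * Complex.I)) = Complex.exp (-(k * Complex.I)) *
            Complex.exp (-(k * (x + -1 : ℤ) * Complex.I)) := by
          rw [← Complex.exp_add]; push_cast; ring_nf
        simp [amplitude, leftPart, rightPart, dotProduct, this, sub_eq_add_neg]
        ring
      · simp [momentumAmplitude, shiftMatrix, Matrix.mulVec, dotProduct]

/-- The walker moves at most one step per unit of time. -/
lemma amplitude_eq_zero_of_lt (U : ℕ → Matrix (Fin 2) (Fin 2) ℂ) (α β : ℂ) (t : ℕ) (x : ℤ)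
    (hx : (t : ℤ) < |x|) : amplitude U α β t x = 0 := by
  induction t generalizing x with
  | zero =>
    have : x ≠ 0 := by rintro rfl; simp at hx
    simp [amplitude, this]
  | succ t ih =>
    have h1 : (t : ℤ) < |x + 1| := by push_cast at hx; rw [lt_abs] at *; omega
    have h2 : (t : ℤ) < |x - 1| := by push_cast at hx; rw [lt_abs] at *; omega
    simp [amplitude, ih _ h1, ih _ h2]

lemma amplitude_eq_zero_of_notMem (U : ℕ → Matrix (Fin 2) (Fin 2) ℂ) (α β : ℂ) (t : ℕ) {x : ℤ}
    (hx : x ∉ Finset.Icc (-t : ℤ) t) : amplitude U α β t x = 0 := by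
  refine amplitude_eq_zero_of_lt U α β t x ?_
  rw [Finset.mem_Icc, ← abs_le, not_le] at hx
  exact hx

lemma momentumAmplitude_eq_sum (U : ℕ → Matrix (Fin 2) (Fin 2) ℂ) (α β : ℂ) (t : ℕ) (k : ℝ)
    (i : Fin 2) :
    momentumAmplitude U α β t k i = ∑ x ∈ Finset.Icc (-t : ℤ) t,
      Complex.exp (-(k * x * Complex.I)) * amplitude U α β t x i := by
  refine (hasSum_momentumAmplitude U α β t k i).unique (hasSum_sum_of_ne_finset_zero ?_)
  intro x hx
  simp [amplitude_eq_zero_of_notMem U α β t hx]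

lemma continuous_momentumAmplitude (U : ℕ → Matrix (Fin 2) (Fin 2) ℂ) (α β : ℂ) (t : ℕ)
    (i : Fin 2) : Continuous fun k => momentumAmplitude U α β t k i := by
  simp only [momentumAmplitude_eq_sum]
  fun_prop

lemma integral_exp_int_mul (m : ℤ) :
    ∫ k in (0 : ℝ)..2 * Real.pi, Complex.exp (k * m * Complex.I) =
      (if m = 0 then 2 * Real.pi else 0 : ℂ) := by
  split_ifs with hm
  · simp [hm]
  · have hc : (m * Complex.I : ℂ) ≠ 0 := by simp [hm]
    have := integral_exp_mul_complex (a := 0) (b := 2 * Real.pi) hc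
    rw [show (fun k : ℝ => Complex.exp (k * m * Complex.I)) =
      fun k : ℝ => Complex.exp (m * Complex.I * k) by funext k; ring_nf, this]
    rw [show (m * Complex.I * (2 * Real.pi : ℝ) : ℂ) = m * (2 * Real.pi * Complex.I) by
      push_cast; ring, Complex.exp_int_mul_two_pi_mul_I]
    simp

/-- Parseval's identity for trigonometric polynomials. -/
lemma integral_conj_sum_mul_sum (s : Finset ℤ) (a b : ℤ → ℂ) :
    ∫ k in (0 : ℝ)..2 * Real.pi, conj (∑ x ∈ s, Complex.exp (-(k * x * Complex.I)) * a x) *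
      ∑ y ∈ s, Complex.exp (-(k * y * Complex.I)) * b y =
      2 * Real.pi * ∑ x ∈ s, conj (a x) * b x := by
  have h : ∀ k : ℝ, conj (∑ x ∈ s, Complex.exp (-(k * x * Complex.I)) * a x) *
      ∑ y ∈ s, Complex.exp (-(k * y * Complex.I)) * b y =
      ∑ x ∈ s, ∑ y ∈ s, conj (a x) * b y * Complex.exp (k * (x - y : ℤ) * Complex.I) := by
    intro k
    rw [map_sum, Finset.sum_mul_sum]
    refine Finset.sum_congr rfl fun x _ => Finset.sum_congr rfl fun y _ => ?_
    rw [map_mul, ← Complex.exp_conj]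
    simp only [map_neg, map_mul, Complex.conj_ofReal, Complex.conj_I, map_intCast]
    rw [show (k * (x - y : ℤ) * Complex.I : ℂ) = -(k * x * -Complex.I) + -(k * y * Complex.I) by
      push_cast; ring, Complex.exp_add]
    ring
  simp_rw [h]
  rw [intervalIntegral.integral_finsetSum fun x _ =>
    Continuous.intervalIntegrable (by fun_prop) _ _, Finset.mul_sum]
  refine Finset.sum_congr rfl fun x hx => ?_
  rw [intervalIntegral.integral_finsetSum fun y _ =>
    Continuous.intervalIntegrable (by fun_prop) _ _]
  have hxy : ∀ y : ℤ, ∫ k in (0 : ℝ)..2 * Real.pi,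
      conj (a x) * b y * Complex.exp (k * (x - y : ℤ) * Complex.I) =
      if x = y then 2 * Real.pi * (conj (a x) * b y) else 0 := by
    intro y
    rw [intervalIntegral.integral_const_mul, integral_exp_int_mul]
    simp only [sub_eq_zero]
    split_ifs <;> ring
  rw [Finset.sum_congr rfl fun y _ => hxy y, Finset.sum_ite_eq, if_pos hx]

/-- The overlap of the momentum amplitudes at `k` and `k - ε`. -/
noncomputable def momentumOverlap (U : ℕ → Matrix (Fin 2) (Fin 2) ℂ) (α β : ℂ) (t : ℕ)
    (k ε : ℝ) : ℂ :=
  star (momentumAmplitude U α β t k) ⬝ᵥ momentumAmplitude U α β t (k - ε)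

lemma continuous_momentumOverlap (U : ℕ → Matrix (Fin 2) (Fin 2) ℂ) (α β : ℂ) (t : ℕ) (ε : ℝ) :
    Continuous fun k => momentumOverlap U α β t k ε := by
  have h := continuous_momentumAmplitude U α β t
  simp only [momentumOverlap, dotProduct, Fin.sum_univ_two, Pi.star_apply]
  have h' := fun i => (h i).comp (continuous_sub_right ε)
  exact ((h 0).star.mul (h' 0)).add ((h 1).star.mul (h' 1))

lemma integral_momentumOverlap (U : ℕ → Matrix (Fin 2) (Fin 2) ℂ) (α β : ℂ) (t : ℕ) (ε : ℝ) :
    ∫ k in (0 : ℝ)..2 * Real.pi, momentumOverlap U α β t k ε =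
      2 * Real.pi * ∑ x ∈ Finset.Icc (-t : ℤ) t,
        (positionProb U α β t x : ℂ) * Complex.exp (ε * x * Complex.I) := by
  have hcomp : ∀ i : Fin 2, ∫ k in (0 : ℝ)..2 * Real.pi,
      conj (momentumAmplitude U α β t k i) * momentumAmplitude U α β t (k - ε) i =
      2 * Real.pi * ∑ x ∈ Finset.Icc (-t : ℤ) t,
        ((‖amplitude U α β t x i‖ ^ 2 : ℝ) : ℂ) * Complex.exp (ε * x * Complex.I) := by
    intro i
    have := integral_conj_sum_mul_sum (Finset.Icc (-t : ℤ) t) (fun x => amplitude U α β t x i)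
      (fun x => Complex.exp (ε * x * Complex.I) * amplitude U α β t x i)
    convert! this using 1
    · refine intervalIntegral.integral_congr fun k _ => ?_
      simp only [momentumAmplitude_eq_sum]
      congr 1
      refine Finset.sum_congr rfl fun x _ => ?_
      rw [← mul_assoc, ← Complex.exp_add]
      congr 2
      push_cast; ring
    · congr 1
      refine Finset.sum_congr rfl fun x _ => ?_
      rw [Complex.ofReal_pow, ← Complex.conj_mul']
      ring
  have hc := continuous_momentumAmplitude U α β t
  have hc' := fun i => (hc i).comp (continuous_sub_right ε)
  simp only [momentumOverlap, dotProduct, Fin.sum_univ_two, Pi.star_apply]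
  refine (intervalIntegral.integral_add
    (((hc 0).star.mul (hc' 0)).intervalIntegrable _ _)
    (((hc 1).star.mul (hc' 1)).intervalIntegrable _ _)).trans ?_
  refine (congrArg₂ (· + ·) (hcomp 0) (hcomp 1)).trans ?_
  rw [← mul_add, ← Finset.sum_add_distrib]
  congr 1
  refine Finset.sum_congr rfl fun x _ => ?_
  simp only [positionProb, Fin.sum_univ_two]
  push_cast; ring

lemma star_mulVec_dotProduct_mulVec {M : Matrix (Fin 2) (Fin 2) ℂ}
    (hM : M ∈ Matrix.unitaryGroup (Fin 2) ℂ) (v w : Fin 2 → ℂ) :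
    star (M.mulVec v) ⬝ᵥ M.mulVec w = star v ⬝ᵥ w := by
  rw [Matrix.star_mulVec, Matrix.dotProduct_mulVec, Matrix.vecMul_vecMul,
    ← Matrix.star_eq_conjTranspose, Matrix.mem_unitaryGroup_iff'.1 hM, Matrix.vecMul_one]

lemma shiftMatrix_mem_unitaryGroup (k : ℝ) :
    shiftMatrix k ∈ Matrix.unitaryGroup (Fin 2) ℂ := by
  rw [Matrix.mem_unitaryGroup_iff, Matrix.star_eq_conjTranspose]
  ext i j
  fin_cases i <;> fin_cases j <;>
    simp [shiftMatrix, Matrix.mul_apply, ← Complex.exp_conj, ← Complex.exp_add]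

lemma star_momentumAmplitude_dotProduct_self {U : ℕ → Matrix (Fin 2) (Fin 2) ℂ}
    (hU : ∀ t, U t ∈ Matrix.unitaryGroup (Fin 2) ℂ) {α β : ℂ} (hαβ : ‖α‖ ^ 2 + ‖β‖ ^ 2 = 1)
    (t : ℕ) (k : ℝ) :
    star (momentumAmplitude U α β t k) ⬝ᵥ momentumAmplitude U α β t k = 1 := by
  induction t with
  | zero =>
    simp only [momentumAmplitude, dotProduct, Fin.sum_univ_two, Pi.star_apply, Matrix.cons_val_zero,
      Matrix.cons_val_one]
    rw [Complex.star_def, Complex.conj_mul', Complex.conj_mul']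
    exact_mod_cast hαβ
  | succ t ih =>
    rw [momentumAmplitude, star_mulVec_dotProduct_mulVec (shiftMatrix_mem_unitaryGroup k),
      star_mulVec_dotProduct_mulVec (hU t), ih]

lemma norm_apply_le_one {v : Fin 2 → ℂ} (hv : star v ⬝ᵥ v = 1) (i : Fin 2) : ‖v i‖ ≤ 1 := by
  have h : ‖v 0‖ ^ 2 + ‖v 1‖ ^ 2 = 1 := by
    simp only [dotProduct, Fin.sum_univ_two, Pi.star_apply, Complex.star_def,
      Complex.conj_mul'] at hv
    exact_mod_cast hv
  have h0 := sq_nonneg ‖v 0‖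
  have h1 := sq_nonneg ‖v 1‖
  refine abs_le_of_sq_le_sq' (a := ‖v i‖) (b := 1) ?_ zero_le_one |>.2
  fin_cases i <;> simp <;> nlinarith

lemma norm_momentumOverlap_le {U : ℕ → Matrix (Fin 2) (Fin 2) ℂ}
    (hU : ∀ t, U t ∈ Matrix.unitaryGroup (Fin 2) ℂ) {α β : ℂ} (hαβ : ‖α‖ ^ 2 + ‖β‖ ^ 2 = 1)
    (t : ℕ) (k ε : ℝ) : ‖momentumOverlap U α β t k ε‖ ≤ 2 := by
  have h := fun k i => norm_apply_le_one (star_momentumAmplitude_dotProduct_self hU hαβ t k) i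
  simp only [momentumOverlap, dotProduct, Fin.sum_univ_two, Pi.star_apply]
  refine (norm_add_le _ _).trans ?_
  rw [norm_mul, norm_mul, norm_star, norm_star]
  have h0 := mul_le_one₀ (h k 0) (norm_nonneg _) (h (k - ε) 0)
  have h1 := mul_le_one₀ (h k 1) (norm_nonneg _) (h (k - ε) 1)
  linarith

lemma sum_positionProb {U : ℕ → Matrix (Fin 2) (Fin 2) ℂ}
    (hU : ∀ t, U t ∈ Matrix.unitaryGroup (Fin 2) ℂ) {α β : ℂ} (hαβ : ‖α‖ ^ 2 + ‖β‖ ^ 2 = 1)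
    (t : ℕ) : ∑ x ∈ Finset.Icc (-t : ℤ) t, positionProb U α β t x = 1 := by
  have h := integral_momentumOverlap U α β t 0
  simp only [momentumOverlap, sub_zero, star_momentumAmplitude_dotProduct_self hU hαβ] at h
  simp only [intervalIntegral.integral_const, Complex.ofReal_zero, zero_mul, Complex.exp_zero,
    mul_one, sub_zero, Complex.real_smul] at h
  have hπ : (2 * Real.pi : ℂ) ≠ 0 := by simp [Real.pi_ne_zero]
  push_cast at h
  have h' : ∑ x ∈ Finset.Icc (-t : ℤ) t, (positionProb U α β t x : ℂ) = 1 :=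
    mul_left_cancel₀ hπ (by rw [mul_one]; exact h.symm)
  exact_mod_cast h'

lemma positionProb_nonneg (U : ℕ → Matrix (Fin 2) (Fin 2) ℂ) (α β : ℂ) (t : ℕ) (x : ℤ) :
    0 ≤ positionProb U α β t x := by
  unfold positionProb; positivity

lemma positionLaw_eq_sum (U : ℕ → Matrix (Fin 2) (Fin 2) ℂ) (α β : ℂ) (t : ℕ) :
    positionLaw U α β t = ∑ x ∈ Finset.Icc (-t : ℤ) t,
      ENNReal.ofReal (positionProb U α β t x) • Measure.dirac x := by
  ext s hs
  rw [positionLaw, Measure.sum_apply _ hs, Measure.finsetSum_apply, tsum_eq_sum]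
  intro x hx
  simp [positionProb, amplitude_eq_zero_of_notMem U α β t hx]

lemma isProbabilityMeasure_positionLaw {U : ℕ → Matrix (Fin 2) (Fin 2) ℂ}
    (hU : ∀ t, U t ∈ Matrix.unitaryGroup (Fin 2) ℂ) {α β : ℂ} (hαβ : ‖α‖ ^ 2 + ‖β‖ ^ 2 = 1)
    (t : ℕ) : IsProbabilityMeasure (positionLaw U α β t) := by
  refine ⟨?_⟩
  rw [positionLaw_eq_sum, Measure.finsetSum_apply]
  simp only [Measure.smul_apply, measure_univ, smul_eq_mul, mul_one]
  rw [← ENNReal.ofReal_sum_of_nonneg fun x _ => positionProb_nonneg U α β t x,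
    sum_positionProb hU hαβ, ENNReal.ofReal_one]

/-- The characteristic function of the rescaled position is a mean of momentum overlaps. -/
lemma charFun_map_positionLaw (U : ℕ → Matrix (Fin 2) (Fin 2) ℂ) (α β : ℂ) (t : ℕ) (ξ : ℝ) :
    charFun ((positionLaw U α β t).map fun x : ℤ => (x : ℝ) / (t : ℝ)) ξ =
      (2 * Real.pi : ℂ)⁻¹ * ∫ k in (0 : ℝ)..2 * Real.pi, momentumOverlap U α β t k (ξ / t) := by
  have hπ : (2 * Real.pi : ℂ) ≠ 0 := by simp [Real.pi_ne_zero]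
  rw [integral_momentumOverlap, inv_mul_cancel_left₀ hπ, charFun_apply_real,
    integral_map (by fun_prop) (by fun_prop), positionLaw_eq_sum,
    integral_finsetSum_measure]
  · refine Finset.sum_congr rfl fun x _ => ?_
    rw [integral_smul_measure, integral_dirac,
      ENNReal.toReal_ofReal (positionProb_nonneg U α β t x), Complex.real_smul]
    congr 2
    push_cast; ring
  · intro x _
    exact (integrable_dirac (by simp)).smul_measure (by simp)

/-! ### Powers in `SU(2)` and the overlap of nearby orbits -/

/-- The matrix with first row `(x, z)` that lies in `SU(2)` when `|x|² + |z|² = 1`. -/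
def quaternionMatrix (x z : ℂ) : Matrix (Fin 2) (Fin 2) ℂ :=
  !![x, z; -conj z, conj x]

/-- The splitting into a scalar and an anti-Hermitian traceless matrix. -/
lemma quaternionMatrix_eq_add (x z : ℂ) :
    quaternionMatrix x z = (x.re : ℂ) • (1 : Matrix (Fin 2) (Fin 2) ℂ) +
      quaternionMatrix (x.im * Complex.I) z := by
  ext i j
  fin_cases i <;> fin_cases j <;> simp [quaternionMatrix]
  apply Complex.ext <;> simp

lemma quaternionMatrix_im_mul_self {x z : ℂ} {θ : ℝ} (hxz : ‖x‖ ^ 2 + ‖z‖ ^ 2 = 1)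
    (hθ : x.re = Real.cos θ) :
    quaternionMatrix (x.im * Complex.I) z * quaternionMatrix (x.im * Complex.I) z =
      (-(Real.sin θ : ℂ) ^ 2) • (1 : Matrix (Fin 2) (Fin 2) ℂ) := by
  have h : x.im ^ 2 + z.re ^ 2 + z.im ^ 2 = Real.sin θ ^ 2 := by
    rw [Complex.sq_norm, Complex.sq_norm, Complex.normSq_apply, Complex.normSq_apply, hθ] at hxz
    linarith [Real.sin_sq_add_cos_sq θ]
  have h' : (x.im : ℂ) ^ 2 + (z.re : ℂ) ^ 2 + (z.im : ℂ) ^ 2 = (Real.sin θ : ℂ) ^ 2 := by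
    exact_mod_cast h
  have hz : z * conj z = (z.re : ℂ) ^ 2 + (z.im : ℂ) ^ 2 := by
    rw [Complex.mul_conj, Complex.normSq_apply]; push_cast; ring
  ext i j
  fin_cases i <;> fin_cases j <;>
    simp [quaternionMatrix, Matrix.mul_apply, -Complex.ofReal_sin]
  · linear_combination (x.im : ℂ) ^ 2 * Complex.I_sq - hz - h'
  · ring
  · ring
  · linear_combination (x.im : ℂ) ^ 2 * Complex.I_sq - hz - h'

/-- De Moivre's formula in `SU(2)`. -/
lemma quaternionMatrix_pow {x z : ℂ} {θ : ℝ} (hxz : ‖x‖ ^ 2 + ‖z‖ ^ 2 = 1)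
    (hθ : x.re = Real.cos θ) (hs : Real.sin θ ≠ 0) (n : ℕ) :
    quaternionMatrix x z ^ n = (Real.cos (n * θ) : ℂ) • (1 : Matrix (Fin 2) (Fin 2) ℂ) +
      (Real.sin (n * θ) * (Real.sin θ : ℂ)⁻¹) • quaternionMatrix (x.im * Complex.I) z := by
  have hs' : (Real.sin θ : ℂ) ≠ 0 := by exact_mod_cast hs
  induction n with
  | zero => simp
  | succ n ih =>
    have hc1 : (Real.cos ((n + 1 : ℕ) * θ) : ℂ) =
        Real.cos (n * θ) * Real.cos θ - Real.sin (n * θ) * Real.sin θ := by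
      rw [← Complex.ofReal_mul, ← Complex.ofReal_mul, ← Complex.ofReal_sub, ← Real.cos_add]
      push_cast; ring_nf
    have hc2 : (Real.sin ((n + 1 : ℕ) * θ) : ℂ) =
        Real.sin (n * θ) * Real.cos θ + Real.cos (n * θ) * Real.sin θ := by
      rw [← Complex.ofReal_mul, ← Complex.ofReal_mul, ← Complex.ofReal_add, ← Real.sin_add]
      push_cast; ring_nf
    rw [pow_succ, ih, quaternionMatrix_eq_add x z, hc1, hc2, hθ]
    simp only [add_mul, mul_add, smul_mul_assoc, mul_smul_comm, one_mul, mul_one,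
      quaternionMatrix_im_mul_self hxz hθ, smul_smul, add_smul, sub_smul]
    clear ih hc1 hc2 hθ
    generalize (Real.sin θ : ℂ) = s at *
    match_scalars <;> field_simp
    ring

/-- `i N φ`, where `N` is the Hermitian involution with `S = cos θ + i sin θ N`,
`S = quaternionMatrix x z`. It is only meaningful if `Re x = cos θ` and `sin θ ≠ 0`. -/
noncomputable def spinVector (x z : ℂ) (φ : Fin 2 → ℂ) (θ : ℝ) : Fin 2 → ℂ :=
  (Real.sin θ : ℂ)⁻¹ • (quaternionMatrix (x.im * Complex.I) z).mulVec φ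

lemma quaternionMatrix_pow_mulVec {x z : ℂ} {θ : ℝ} (hxz : ‖x‖ ^ 2 + ‖z‖ ^ 2 = 1)
    (hθ : x.re = Real.cos θ) (hs : Real.sin θ ≠ 0) (n : ℕ) (φ : Fin 2 → ℂ) :
    (quaternionMatrix x z ^ n).mulVec φ =
      (Real.cos (n * θ) : ℂ) • φ + (Real.sin (n * θ) : ℂ) • spinVector x z φ θ := by
  rw [quaternionMatrix_pow hxz hθ hs, Matrix.add_mulVec, Matrix.smul_mulVec, Matrix.smul_mulVec,
    Matrix.one_mulVec, spinVector, smul_smul]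

lemma conjTranspose_quaternionMatrix_im (y : ℝ) (z : ℂ) :
    (quaternionMatrix (y * Complex.I) z).conjTranspose = -quaternionMatrix (y * Complex.I) z := by
  ext i j
  fin_cases i <;> fin_cases j <;> simp [quaternionMatrix]

lemma star_spinVector_dotProduct {x z : ℂ} {θ : ℝ} (φ ψ : Fin 2 → ℂ) :
    star (spinVector x z φ θ) ⬝ᵥ ψ = -(star φ ⬝ᵥ spinVector x z ψ θ) := by
  rw [spinVector, spinVector, star_smul, Matrix.star_mulVec, conjTranspose_quaternionMatrix_im,
    smul_dotProduct, Matrix.vecMul_neg, neg_dotProduct, ← Matrix.dotProduct_mulVec,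
    dotProduct_smul, Complex.star_def, map_inv₀, Complex.conj_ofReal, smul_neg]

lemma star_spinVector_dotProduct_self {x z : ℂ} {θ : ℝ} (hxz : ‖x‖ ^ 2 + ‖z‖ ^ 2 = 1)
    (hθ : x.re = Real.cos θ) (hs : Real.sin θ ≠ 0) (φ : Fin 2 → ℂ) :
    star (spinVector x z φ θ) ⬝ᵥ spinVector x z φ θ = star φ ⬝ᵥ φ := by
  have hs' : (Real.sin θ : ℂ) ≠ 0 := by exact_mod_cast hs
  have : spinVector x z (spinVector x z φ θ) θ = -φ := by
    rw [spinVector, spinVector, Matrix.mulVec_smul, Matrix.mulVec_mulVec,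
      quaternionMatrix_im_mul_self hxz hθ, Matrix.smul_mulVec, Matrix.one_mulVec, smul_smul,
      smul_smul]
    rw [show (Real.sin θ : ℂ)⁻¹ * (Real.sin θ : ℂ)⁻¹ * -(Real.sin θ : ℂ) ^ 2 = -1 by
      field_simp, neg_one_smul]
  rw [star_spinVector_dotProduct, this, dotProduct_neg, neg_neg]

/-- The oscillating phases cancel in the overlap of two orbits of `SU(2)` at nearby momenta: only
the phase difference `n (θ(u - δ) - θ(u)) → -ξ θ'(u)` survives. -/
lemma tendsto_overlap_pow {ι : Type*} {l : Filter ι} {x z : ℝ → ℂ} {θ : ℝ → ℝ} {u h ξ : ℝ}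
    (hx : Continuous x) (hz : Continuous z) (hxz : ∀ u, ‖x u‖ ^ 2 + ‖z u‖ ^ 2 = 1)
    (hθ : ∀ u, (x u).re = Real.cos (θ u)) (hd : HasDerivAt θ h u) (hs : Real.sin (θ u) ≠ 0)
    {φ : Fin 2 → ℂ} (hφ : star φ ⬝ᵥ φ = 1) {δ : ι → ℝ} {n : ι → ℕ} (hδ : Tendsto δ l (𝓝 0))
    (hnδ : Tendsto (fun t => n t * δ t) l (𝓝 ξ)) :
    Tendsto (fun t => star ((quaternionMatrix (x u) (z u) ^ n t).mulVec φ) ⬝ᵥ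
        (quaternionMatrix (x (u - δ t)) (z (u - δ t)) ^ n t).mulVec φ) l
      (𝓝 (Real.cos (ξ * h) -
        Real.sin (ξ * h) * (star φ ⬝ᵥ spinVector (x u) (z u) φ (θ u)))) := by
  have hu : Tendsto (fun t => u - δ t) l (𝓝 u) := by simpa using hδ.const_sub u
  have hθu : Tendsto (fun t => θ (u - δ t)) l (𝓝 (θ u)) := hd.continuousAt.tendsto.comp hu
  have hsin : Tendsto (fun t => Real.sin (θ (u - δ t))) l (𝓝 (Real.sin (θ u))) :=
    (Real.continuous_sin.tendsto _).comp hθu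
  have hphase : Tendsto (fun t => n t * θ (u - δ t) - n t * θ u) l (𝓝 (-(ξ * h))) := by
    have := hd.hasFDerivAt.hasFDerivWithinAt (s := Set.univ) |>.lim (c := fun t => (n t : ℝ))
      (d := fun t => -δ t) (v := -ξ) (l := l) (by simpa using hδ.neg) (by simp)
      (by simpa using hnδ.neg)
    simpa [mul_add, sub_eq_add_neg] using this
  set y := spinVector (x u) (z u) φ (θ u) with hy
  set y' := fun t => spinVector (x (u - δ t)) (z (u - δ t)) φ (θ (u - δ t)) with hy'
  have hylim : ∀ v : Fin 2 → ℂ, Tendsto (fun t => star v ⬝ᵥ (y' t - y)) l (𝓝 0) := by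
    intro v
    have h1 : Tendsto y' l (𝓝 y) := by
      have hq : Continuous fun u => (quaternionMatrix ((x u).im * Complex.I) (z u)).mulVec φ := by
        unfold quaternionMatrix
        have h1 := Complex.continuous_im.comp hx
        have h2 := Complex.continuous_conj.comp hz
        refine continuous_pi fun i => ?_
        fin_cases i <;> simp [Matrix.mulVec, dotProduct] <;> fun_prop
      refine Tendsto.smul ?_ ((hq.tendsto u).comp hu)
      exact ((Complex.continuous_ofReal.tendsto _).comp hsin).inv₀ (by exact_mod_cast hs)
    have hc : Continuous fun w : Fin 2 → ℂ => star v ⬝ᵥ (w - y) := by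
      simp only [dotProduct, Fin.sum_univ_two]; fun_prop
    have := (hc.tendsto y).comp h1
    rwa [sub_self, dotProduct_zero] at this
  have hrem : Tendsto (fun t => (Real.cos (n t * θ u) * Real.sin (n t * θ (u - δ t)) : ℂ) *
      (star φ ⬝ᵥ (y' t - y)) + (Real.sin (n t * θ u) * Real.sin (n t * θ (u - δ t)) : ℂ) *
      (star y ⬝ᵥ (y' t - y))) l (𝓝 0) := by
    have hb := (hylim φ).norm.add (hylim y).norm
    rw [norm_zero, add_zero] at hb
    refine squeeze_zero_norm (fun t => ?_) hb
    have e : ∀ a b : ℝ, |a| ≤ 1 → |b| ≤ 1 → ∀ w : ℂ, ‖(a * b : ℂ) * w‖ ≤ ‖w‖ := by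
      intro a b ha hb w
      rw [norm_mul, norm_mul, Complex.norm_real, Complex.norm_real, Real.norm_eq_abs,
        Real.norm_eq_abs]
      exact mul_le_of_le_one_left (norm_nonneg _) (mul_le_one₀ ha (abs_nonneg _) hb)
    exact (norm_add_le _ _).trans (add_le_add
      (e _ _ (Real.abs_cos_le_one _) (Real.abs_sin_le_one _) _)
      (e _ _ (Real.abs_sin_le_one _) (Real.abs_sin_le_one _) _))
  have hcos : Tendsto (fun t => ((Real.cos (n t * θ (u - δ t) - n t * θ u) : ℝ) : ℂ)) l
      (𝓝 (Real.cos (ξ * h) : ℝ)) := by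
    rw [← Real.cos_neg]
    exact (Complex.continuous_ofReal.tendsto _).comp ((Real.continuous_cos.tendsto _).comp hphase)
  have hsin' : Tendsto (fun t => ((Real.sin (n t * θ (u - δ t) - n t * θ u) : ℝ) : ℂ)) l
      (𝓝 (-Real.sin (ξ * h) : ℝ)) := by
    rw [← Real.sin_neg]
    exact (Complex.continuous_ofReal.tendsto _).comp ((Real.continuous_sin.tendsto _).comp hphase)
  have hmain := (hcos.add (hsin'.mul_const (star φ ⬝ᵥ y))).add hrem
  rw [show ((Real.cos (ξ * h) : ℝ) : ℂ) + (-Real.sin (ξ * h) : ℝ) * (star φ ⬝ᵥ y) + 0 =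
    Real.cos (ξ * h) - Real.sin (ξ * h) * (star φ ⬝ᵥ y) by push_cast; ring] at hmain
  refine hmain.congr' ?_
  filter_upwards [hsin.eventually_ne hs] with t ht
  rw [quaternionMatrix_pow_mulVec (hxz _) (hθ _) hs, quaternionMatrix_pow_mulVec (hxz _) (hθ _) ht]
  have hyφ : star y ⬝ᵥ φ = -(star φ ⬝ᵥ y) := star_spinVector_dotProduct φ φ
  have hyy : star y ⬝ᵥ y = 1 := (star_spinVector_dotProduct_self (hxz u) (hθ u) hs φ).trans hφ
  simp only [star_add, star_smul, add_dotProduct, dotProduct_add, smul_dotProduct, dotProduct_smul,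
    dotProduct_sub, smul_eq_mul, ← hy, Complex.star_def, Complex.conj_ofReal, hyφ, hyy, hφ,
    Real.cos_sub, Real.sin_sub, Complex.ofReal_add, Complex.ofReal_sub, Complex.ofReal_mul]
  simp only [hy']
  ring

/-! ### The two-step evolution -/

/-- The diagonal entry of the two-step evolution `e^{-is} D(k) H₁ D(k) H₀`, where `D(k)` is
`shiftMatrix k` and `e^{2is} = det H₀ det H₁`. Here `aᵢ`, `bᵢ` is the first row of `Hᵢ`,
`u = 2k - s`, and `κ = det H₀ e^{-is}`. -/
noncomputable def twoStepDiag (a₀ b₀ a₁ b₁ : ℝ) (κ : ℂ) (u : ℝ) : ℂ :=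
  Complex.exp (u * Complex.I) * (a₁ * a₀) - κ * (b₁ * b₀)

/-- The upper right entry of the two-step evolution, with the conventions of `twoStepDiag`. -/
noncomputable def twoStepOff (a₀ b₀ a₁ b₁ : ℝ) (κ : ℂ) (u : ℝ) : ℂ :=
  Complex.exp (u * Complex.I) * (a₁ * b₀) + κ * (b₁ * a₀)

lemma continuous_twoStepDiag (a₀ b₀ a₁ b₁ : ℝ) (κ : ℂ) :
    Continuous (twoStepDiag a₀ b₀ a₁ b₁ κ) := by
  unfold twoStepDiag; fun_prop

lemma continuous_twoStepOff (a₀ b₀ a₁ b₁ : ℝ) (κ : ℂ) : Continuous (twoStepOff a₀ b₀ a₁ b₁ κ) := by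
  unfold twoStepOff; fun_prop

lemma norm_sq_twoStep {a₀ b₀ a₁ b₁ : ℝ} {κ : ℂ} (h₀ : a₀ ^ 2 + b₀ ^ 2 = 1)
    (h₁ : a₁ ^ 2 + b₁ ^ 2 = 1) (hκ : ‖κ‖ = 1) (u : ℝ) :
    ‖twoStepDiag a₀ b₀ a₁ b₁ κ u‖ ^ 2 + ‖twoStepOff a₀ b₀ a₁ b₁ κ u‖ ^ 2 = 1 := by
  have hk : κ.re * κ.re + κ.im * κ.im = 1 := by
    rw [← Complex.normSq_apply, ← Complex.sq_norm, hκ, one_pow]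
  have hu := Real.sin_sq_add_cos_sq u
  rw [Complex.sq_norm, Complex.sq_norm, Complex.normSq_apply, Complex.normSq_apply]
  simp only [twoStepDiag, twoStepOff, Complex.sub_re, Complex.sub_im, Complex.add_re,
    Complex.add_im, Complex.mul_re, Complex.mul_im, Complex.ofReal_re, Complex.ofReal_im,
    Complex.exp_ofReal_mul_I_re, Complex.exp_ofReal_mul_I_im]
  linear_combination a₁ ^ 2 * (a₀ ^ 2 + b₀ ^ 2) * hu + b₁ ^ 2 * (a₀ ^ 2 + b₀ ^ 2) * hk +
    (a₁ ^ 2 + b₁ ^ 2) * h₀ + h₁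

lemma twoStepDiag_re (a₀ b₀ a₁ b₁ : ℝ) (κ : ℂ) (u : ℝ) :
    (twoStepDiag a₀ b₀ a₁ b₁ κ u).re = a₀ * a₁ * Real.cos u + -(κ.re * (b₀ * b₁)) := by
  simp [twoStepDiag, Complex.exp_ofReal_mul_I_re, -Complex.ofReal_cos]
  ring

/-- The dispersion relation `cos θ = p cos u + q` has a real solution for every `u`. -/
lemma abs_add_abs_twoStep_le {a₀ b₀ a₁ b₁ : ℝ} {κ : ℂ} (h₀ : a₀ ^ 2 + b₀ ^ 2 = 1)
    (h₁ : a₁ ^ 2 + b₁ ^ 2 = 1) (hκ : ‖κ‖ = 1) :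
    |a₀ * a₁| + |-(κ.re * (b₀ * b₁))| ≤ 1 := by
  have hk : |κ.re| ≤ 1 := hκ ▸ Complex.abs_re_le_norm κ
  rw [abs_neg, abs_mul, abs_mul, abs_mul b₀]
  have := mul_le_of_le_one_left (mul_nonneg (abs_nonneg b₀) (abs_nonneg b₁)) hk
  nlinarith [sq_abs a₀, sq_abs a₁, sq_abs b₀, sq_abs b₁, sq_nonneg (|a₀| - |a₁|),
    sq_nonneg (|b₀| - |b₁|)]

/-- The second row of an orthogonal matrix is determined by the first row and the determinant. -/
lemma orthogonal_fin_two {H : Matrix (Fin 2) (Fin 2) ℝ}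
    (hH : H ∈ Matrix.orthogonalGroup (Fin 2) ℝ) :
    H 0 0 ^ 2 + H 0 1 ^ 2 = 1 ∧ H.det ^ 2 = 1 ∧ H 1 0 = -(H.det * H 0 1) ∧
      H 1 1 = H.det * H 0 0 := by
  have h := (Matrix.mem_orthogonalGroup_iff _ _).1 hH
  have e00 := congrFun (congrFun h 0) 0
  have e01 := congrFun (congrFun h 0) 1
  have e11 := congrFun (congrFun h 1) 1
  simp [Matrix.mul_apply] at e00 e01 e11
  rw [Matrix.det_fin_two]
  refine ⟨by linarith, ?_, ?_, ?_⟩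
  · linear_combination (H 1 0 * H 1 0 + H 1 1 * H 1 1) * e00 + e11 -
      (H 0 0 * H 1 0 + H 0 1 * H 1 1) * e01
  · linear_combination -(H 1 0) * e00 + H 0 0 * e01
  · linear_combination -(H 1 1) * e00 + H 0 1 * e01

lemma twoPeriodCoin_mem_unitaryGroup {H₀ H₁ : Matrix (Fin 2) (Fin 2) ℝ}
    (hH₀ : H₀ ∈ Matrix.orthogonalGroup (Fin 2) ℝ) (hH₁ : H₁ ∈ Matrix.orthogonalGroup (Fin 2) ℝ)
    (t : ℕ) : twoPeriodCoin H₀ H₁ t ∈ Matrix.unitaryGroup (Fin 2) ℂ := by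
  have key : ∀ H ∈ Matrix.orthogonalGroup (Fin 2) ℝ,
      H.map Complex.ofReal ∈ Matrix.unitaryGroup (Fin 2) ℂ := by
    intro H hH
    rw [Matrix.mem_unitaryGroup_iff]
    have h := congrArg (fun M : Matrix (Fin 2) (Fin 2) ℝ => M.map Complex.ofRealHom)
      ((Matrix.mem_orthogonalGroup_iff _ _).1 hH)
    simp only [Matrix.map_mul] at h
    convert! h using 2
    · ext i j; simp
    · simp
  unfold twoPeriodCoin
  split_ifs
  · exact key _ hH₀
  · exact key _ hH₁

/-- Two steps of the walk in momentum space: up to the constant phase `e^{is}`, the square root of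
the product of the determinants, the evolution lies in `SU(2)` and depends on `u = 2k - s`. -/
lemma momentumAmplitude_two_mul {H₀ H₁ : Matrix (Fin 2) (Fin 2) ℝ}
    (hH₀ : H₀ ∈ Matrix.orthogonalGroup (Fin 2) ℝ) (hH₁ : H₁ ∈ Matrix.orthogonalGroup (Fin 2) ℝ)
    {s : ℝ} {κ : ℂ} (hs : Complex.exp (s * Complex.I) ^ 2 = H₀.det * H₁.det)
    (hκ : κ = H₀.det * Complex.exp (-(s * Complex.I))) (α β : ℂ) (n : ℕ) (k : ℝ) :
    momentumAmplitude (twoPeriodCoin H₀ H₁) α β (2 * n) k =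
      Complex.exp (s * Complex.I) ^ n •
        (quaternionMatrix (twoStepDiag (H₀ 0 0) (H₀ 0 1) (H₁ 0 0) (H₁ 0 1) κ (2 * k - s))
          (twoStepOff (H₀ 0 0) (H₀ 0 1) (H₁ 0 0) (H₁ 0 1) κ (2 * k - s)) ^ n).mulVec ![α, β] := by
  obtain ⟨-, hd₀, hc₀, hg₀⟩ := orthogonal_fin_two hH₀
  obtain ⟨-, hd₁, hc₁, hg₁⟩ := orthogonal_fin_two hH₁
  have hstep : shiftMatrix k * (H₁.map Complex.ofReal * (shiftMatrix k * H₀.map Complex.ofReal)) =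
      Complex.exp (s * Complex.I) •
        quaternionMatrix (twoStepDiag (H₀ 0 0) (H₀ 0 1) (H₁ 0 0) (H₁ 0 1) κ (2 * k - s))
          (twoStepOff (H₀ 0 0) (H₀ 0 1) (H₁ 0 0) (H₁ 0 1) κ (2 * k - s)) := by
    have e1 : Complex.exp (((2 * k - s : ℝ) : ℂ) * Complex.I) =
        Complex.exp (k * Complex.I) ^ 2 * Complex.exp (-(s * Complex.I)) := by
      rw [← Complex.exp_nat_mul, ← Complex.exp_add]; push_cast; ring_nf
    have e2 : conj (Complex.exp (k * Complex.I)) = Complex.exp (-(k * Complex.I)) := by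
      rw [← Complex.exp_conj]; simp
    have e3 : conj (Complex.exp (-(s * Complex.I))) = Complex.exp (s * Complex.I) := by
      rw [← Complex.exp_conj]; simp
    have e4 : Complex.exp (k * Complex.I) * Complex.exp (-(k * Complex.I)) = 1 := by
      rw [← Complex.exp_add]; simp
    have e5 : Complex.exp (s * Complex.I) * Complex.exp (-(s * Complex.I)) = 1 := by
      rw [← Complex.exp_add]; simp
    have hd₀' : (H₀.det : ℂ) ^ 2 = 1 := by exact_mod_cast hd₀
    have hd₁' : (H₁.det : ℂ) ^ 2 = 1 := by exact_mod_cast hd₁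
    ext i j
    fin_cases i <;> fin_cases j <;>
      simp only [Fin.zero_eta, Fin.mk_one, Fin.isValue, Matrix.mul_apply, Fin.sum_univ_two,
        shiftMatrix, quaternionMatrix, twoStepDiag, twoStepOff, Matrix.smul_apply, Matrix.map_apply,
        Matrix.of_apply, Matrix.cons_val', Matrix.cons_val_zero, Matrix.cons_val_one,
        Matrix.cons_val_fin_one, hc₀, hg₀, hc₁, hg₁, e1, hκ, map_sub, map_add, map_mul, map_pow,
        e2, e3, Complex.conj_ofReal, smul_eq_mul, Complex.ofReal_neg, Complex.ofReal_mul]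
    all_goals
      clear e1 e2 e3 hκ
      generalize Complex.exp (k * Complex.I) = E at *
      generalize Complex.exp (-(k * Complex.I)) = E' at *
      generalize Complex.exp (s * Complex.I) = L at *
      generalize Complex.exp (-(s * Complex.I)) = L' at *
    · linear_combination -(H₁ 0 1 * H₀.det * H₀ 0 1 : ℂ) * e4 -
        (E ^ 2 * H₁ 0 0 * H₀ 0 0 - H₀.det * H₁ 0 1 * H₀ 0 1) * e5
    · linear_combination (H₁ 0 1 * H₀.det * H₀ 0 0 : ℂ) * e4 -
        (E ^ 2 * H₁ 0 0 * H₀ 0 1 + H₀.det * H₁ 0 1 * H₀ 0 0) * e5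
    · linear_combination -(H₁.det * H₁ 0 1 * H₀ 0 0 : ℂ) * e4 +
        (E' ^ 2 * H₁ 0 0 * H₀ 0 1 + H₀.det * H₁ 0 1 * H₀ 0 0) * hs +
        (H₁.det * H₁ 0 1 * H₀ 0 0) * hd₀'
    · linear_combination -(H₁.det * H₁ 0 1 * H₀ 0 1 : ℂ) * e4 -
        (E' ^ 2 * H₁ 0 0 * H₀ 0 0 - H₀.det * H₁ 0 1 * H₀ 0 1) * hs +
        (H₁.det * H₁ 0 1 * H₀ 0 1) * hd₀'
  induction n with
  | zero => simp [momentumAmplitude]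
  | succ n ih =>
    have h1 : twoPeriodCoin H₀ H₁ (2 * n) = H₀.map Complex.ofReal := by
      simp [twoPeriodCoin]
    have h2 : twoPeriodCoin H₀ H₁ (2 * n + 1) = H₁.map Complex.ofReal := by
      simp [twoPeriodCoin]
    rw [show 2 * (n + 1) = 2 * n + 1 + 1 by ring, momentumAmplitude, momentumAmplitude, h1, h2, ih]
    simp only [Matrix.mulVec_mulVec]
    rw [hstep, Matrix.mulVec_smul, Matrix.smul_mulVec, pow_succ', pow_succ',
      Matrix.mulVec_mulVec, smul_smul, mul_comm]

/-- A single step changes the overlap at momentum distance `ε` by `O(ε)`. -/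
lemma norm_momentumOverlap_succ_sub_le {U : ℕ → Matrix (Fin 2) (Fin 2) ℂ}
    (hU : ∀ t, U t ∈ Matrix.unitaryGroup (Fin 2) ℂ) {α β : ℂ} (hαβ : ‖α‖ ^ 2 + ‖β‖ ^ 2 = 1)
    (t : ℕ) (k ε : ℝ) :
    ‖momentumOverlap U α β (t + 1) k ε - momentumOverlap U α β t k ε‖ ≤ 2 * |ε| := by
  set w := (U t).mulVec (momentumAmplitude U α β t k) with hw
  set w' := (U t).mulVec (momentumAmplitude U α β t (k - ε)) with hw'
  have h1 : star w ⬝ᵥ w = 1 := by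
    rw [hw, star_mulVec_dotProduct_mulVec (hU t), star_momentumAmplitude_dotProduct_self hU hαβ]
  have h2 : star w' ⬝ᵥ w' = 1 := by
    rw [hw', star_mulVec_dotProduct_mulVec (hU t), star_momentumAmplitude_dotProduct_self hU hαβ]
  have h3 : momentumOverlap U α β t k ε = star w ⬝ᵥ w' := by
    rw [hw, hw', star_mulVec_dotProduct_mulVec (hU t), momentumOverlap]
  have h4 : momentumOverlap U α β (t + 1) k ε =
      star ((shiftMatrix k).mulVec w) ⬝ᵥ (shiftMatrix (k - ε)).mulVec w' := rfl
  have e1 : conj (Complex.exp (k * Complex.I)) * Complex.exp ((k - ε : ℝ) * Complex.I) =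
      Complex.exp (Complex.I * (-ε : ℝ)) := by
    rw [← Complex.exp_conj, ← Complex.exp_add]; simp; ring_nf
  have e2 : conj (Complex.exp (-(k * Complex.I))) * Complex.exp (-((k - ε : ℝ) * Complex.I)) =
      Complex.exp (Complex.I * (ε : ℝ)) := by
    rw [← Complex.exp_conj, ← Complex.exp_add]; simp; ring_nf
  have h5 : momentumOverlap U α β (t + 1) k ε - momentumOverlap U α β t k ε =
      (Complex.exp (Complex.I * (-ε : ℝ)) - 1) * (conj (w 0) * w' 0) +
      (Complex.exp (Complex.I * (ε : ℝ)) - 1) * (conj (w 1) * w' 1) := by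
    rw [h4, h3, ← e1, ← e2]
    simp only [dotProduct, Matrix.mulVec, Fin.sum_univ_two, shiftMatrix, Pi.star_apply,
      Matrix.of_apply, Matrix.cons_val', Matrix.cons_val_zero, Matrix.cons_val_one,
      Matrix.cons_val_fin_one, Complex.star_def, map_add, map_mul, map_zero, zero_mul, add_zero,
      zero_add]
    ring
  have hb : ∀ (η : ℝ) (i : Fin 2), ‖(Complex.exp (Complex.I * η) - 1) * (conj (w i) * w' i)‖ ≤
      |η| := by
    intro η i
    rw [norm_mul, norm_mul, RCLike.norm_conj]
    exact (mul_le_of_le_one_right (norm_nonneg _) (mul_le_one₀ (norm_apply_le_one h1 i)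
      (norm_nonneg _) (norm_apply_le_one h2 i))).trans (Real.norm_exp_I_mul_ofReal_sub_one_le)
  rw [h5]
  refine (norm_add_le _ _).trans ((add_le_add (hb _ _) (hb _ _)).trans ?_)
  rw [abs_neg]; linarith

lemma norm_momentumOverlap_sub_two_mul_half_le {U : ℕ → Matrix (Fin 2) (Fin 2) ℂ}
    (hU : ∀ t, U t ∈ Matrix.unitaryGroup (Fin 2) ℂ) {α β : ℂ} (hαβ : ‖α‖ ^ 2 + ‖β‖ ^ 2 = 1)
    (t : ℕ) (k ε : ℝ) :
    ‖momentumOverlap U α β t k ε - momentumOverlap U α β (2 * (t / 2)) k ε‖ ≤ 2 * |ε| := by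
  rcases Nat.mod_two_eq_zero_or_one t with h | h
  · rw [show 2 * (t / 2) = t by omega, sub_self, norm_zero]; positivity
  · have := norm_momentumOverlap_succ_sub_le hU hαβ (2 * (t / 2)) k ε
    rwa [show 2 * (t / 2) + 1 = t by omega] at this

lemma tendsto_half_mul_two_div (ξ : ℝ) :
    Tendsto (fun t : ℕ => ((t / 2 : ℕ) : ℝ) * (2 * (ξ / t))) atTop (𝓝 ξ) := by
  have h : Tendsto (fun t : ℕ => ξ - ((t % 2 : ℕ) : ℝ) * (ξ / t)) atTop (𝓝 (ξ - 0)) := by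
    refine tendsto_const_nhds.sub ?_
    refine squeeze_zero_norm (a := fun t : ℕ => |ξ / t|) (fun t => ?_) ?_
    · rw [norm_mul, Real.norm_eq_abs, Real.norm_eq_abs, Nat.abs_cast]
      refine mul_le_of_le_one_left (abs_nonneg _) ?_
      exact_mod_cast Nat.lt_succ_iff.1 (Nat.mod_lt t two_pos)
    · simpa using (tendsto_const_div_atTop_nhds_zero_nat ξ).abs
  rw [sub_zero] at h
  refine h.congr' ?_
  filter_upwards [eventually_gt_atTop 0] with t ht
  have ht' : (t : ℝ) ≠ 0 := by positivity
  have : ((t % 2 : ℕ) : ℝ) + 2 * ((t / 2 : ℕ) : ℝ) = t := by exact_mod_cast Nat.mod_add_div t 2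
  field_simp
  linear_combination -ξ * this

/-- The phase `θ(u)` of the two-step evolution, `cos θ(u) = p cos u + q`, chosen in `[0, π]`. -/
noncomputable def dispersion (p q u : ℝ) : ℝ := Real.arccos (p * Real.cos u + q)

lemma cos_dispersion {p q : ℝ} (hpq : |p| + |q| ≤ 1) (u : ℝ) :
    Real.cos (dispersion p q u) = p * Real.cos u + q := by
  have : |p * Real.cos u + q| ≤ 1 := by
    refine (abs_add_le _ _).trans (le_trans ?_ hpq)
    rw [abs_mul]
    have := mul_le_of_le_one_right (abs_nonneg p) (Real.abs_cos_le_one u)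
    linarith
  exact Real.cos_arccos (abs_le.1 this).1 (abs_le.1 this).2

lemma sin_dispersion (p q u : ℝ) :
    Real.sin (dispersion p q u) = √(1 - (p * Real.cos u + q) ^ 2) := Real.sin_arccos _

lemma sin_dispersion_ne_zero {p q u : ℝ} (hp : p ≠ 0) (hpq : |p| + |q| ≤ 1)
    (hu : Real.sin u ≠ 0) : Real.sin (dispersion p q u) ≠ 0 := by
  rw [sin_dispersion]
  exact (Real.sqrt_pos.2 (by linarith [sq_add_mul_cos_lt_one hp hpq hu])).ne'

lemma hasDerivAt_dispersion {p q u : ℝ} (hp : p ≠ 0) (hpq : |p| + |q| ≤ 1)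
    (hu : Real.sin u ≠ 0) : HasDerivAt (dispersion p q) (groupVelocity p q u) u := by
  have hlt := sq_add_mul_cos_lt_one hp hpq hu
  have h1 : p * Real.cos u + q ≠ -1 := by intro h; rw [h] at hlt; norm_num at hlt
  have h2 : p * Real.cos u + q ≠ 1 := by intro h; rw [h] at hlt; norm_num at hlt
  have := (Real.hasDerivAt_arccos h1 h2).comp u
    (((Real.hasDerivAt_cos u).const_mul p).add_const q)
  refine this.congr_deriv ?_
  unfold groupVelocity
  ring

lemma star_dotProduct_spinVector (x z α β : ℂ) (θ : ℝ) :
    star ![α, β] ⬝ᵥ spinVector x z ![α, β] θ = (Real.sin θ : ℂ)⁻¹ *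
      (Complex.I * (x.im * ((‖α‖ ^ 2 - ‖β‖ ^ 2 : ℝ) : ℂ)) +
        (conj α * β * z - α * conj β * conj z)) := by
  rw [Complex.ofReal_sub, Complex.ofReal_pow, Complex.ofReal_pow, ← Complex.conj_mul',
    ← Complex.conj_mul']
  simp [spinVector, quaternionMatrix, dotProduct, -Complex.ofReal_sin]
  ring

/-- Only the part of the spin expectation that is odd in `u` matters; it is proportional to the
group velocity. -/
lemma spin_sub_spin_neg {a₀ b₀ a₁ b₁ : ℝ} {κ : ℂ} (ha₀ : a₀ ≠ 0) (α β : ℂ) (u : ℝ) {p q : ℝ}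
    (hp : p = a₀ * a₁) :
    star ![α, β] ⬝ᵥ spinVector (twoStepDiag a₀ b₀ a₁ b₁ κ u) (twoStepOff a₀ b₀ a₁ b₁ κ u)
        ![α, β] (dispersion p q u) -
      star ![α, β] ⬝ᵥ spinVector (twoStepDiag a₀ b₀ a₁ b₁ κ (-u)) (twoStepOff a₀ b₀ a₁ b₁ κ (-u))
        ![α, β] (dispersion p q (-u)) =
      2 * Complex.I * (((‖α‖ ^ 2 - ‖β‖ ^ 2 + (α * conj β + conj α * β).re * b₀ / a₀ : ℝ) : ℂ) *
        groupVelocity p q u) := by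
  have hr : ((α * conj β + conj α * β).re : ℂ) = α * conj β + conj α * β := by
    rw [← Complex.conj_eq_iff_re]; simp; ring
  have him : (twoStepDiag a₀ b₀ a₁ b₁ κ u).im - (twoStepDiag a₀ b₀ a₁ b₁ κ (-u)).im =
      2 * Real.sin u * (a₁ * a₀) := by
    simp only [twoStepDiag, Complex.sub_im, Complex.mul_im, Complex.ofReal_re, Complex.ofReal_im,
      Complex.exp_ofReal_mul_I_re, Complex.exp_ofReal_mul_I_im, Real.sin_neg, Real.cos_neg]
    simp
    ring
  have him' : ((twoStepDiag a₀ b₀ a₁ b₁ κ u).im : ℂ) - (twoStepDiag a₀ b₀ a₁ b₁ κ (-u)).im =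
      2 * Real.sin u * (a₁ * a₀) := by exact_mod_cast him
  have hz : twoStepOff a₀ b₀ a₁ b₁ κ u - twoStepOff a₀ b₀ a₁ b₁ κ (-u) =
      2 * Real.sin u * (a₁ * b₀) * Complex.I := by
    simp only [twoStepOff, Complex.exp_mul_I, Complex.ofReal_neg, Complex.cos_neg, Complex.sin_neg,
      Complex.ofReal_sin]
    ring
  have hz' : conj (twoStepOff a₀ b₀ a₁ b₁ κ u) - conj (twoStepOff a₀ b₀ a₁ b₁ κ (-u)) =
      -(2 * Real.sin u * (a₁ * b₀) * Complex.I) := by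
    rw [← map_sub, hz]; simp [-Complex.ofReal_sin, map_ofNat]
  have hθ : dispersion p q (-u) = dispersion p q u := by simp [dispersion]
  have ha : (a₀ : ℂ) ≠ 0 := by exact_mod_cast ha₀
  rw [star_dotProduct_spinVector, star_dotProduct_spinVector, hθ, groupVelocity,
    ← sin_dispersion p q u, hp, ← mul_sub]
  push_cast [-Complex.ofReal_sin]
  rw [hr]
  have e : ∀ S G : ℂ, 2 * Complex.I * (((‖α‖ : ℂ) ^ 2 - (‖β‖ : ℂ) ^ 2 +
      (α * conj β + conj α * β) * b₀ / a₀) * (a₀ * a₁ * S / G)) =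
      G⁻¹ * (2 * Complex.I * S * a₁ * (((‖α‖ : ℂ) ^ 2 - (‖β‖ : ℂ) ^ 2) * a₀ +
      (α * conj β + conj α * β) * b₀)) := by
    intro S G
    rw [div_eq_mul_inv _ G]
    field_simp
  rw [e]
  congr 1
  linear_combination Complex.I * ((‖α‖ : ℂ) ^ 2 - (‖β‖ : ℂ) ^ 2) * him' + conj α * β * hz -
    α * conj β * hz'

/-! ### The limit of the characteristic functions -/

/-- The pointwise limit of the momentum overlap, away from the degenerate momenta. -/
lemma tendsto_momentumOverlap {H₀ H₁ : Matrix (Fin 2) (Fin 2) ℝ}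
    (hH₀ : H₀ ∈ Matrix.orthogonalGroup (Fin 2) ℝ) (hH₁ : H₁ ∈ Matrix.orthogonalGroup (Fin 2) ℝ)
    {s : ℝ} {κ : ℂ} (hs : Complex.exp (s * Complex.I) ^ 2 = H₀.det * H₁.det)
    (hκ : κ = H₀.det * Complex.exp (-(s * Complex.I))) {α β : ℂ} (hαβ : ‖α‖ ^ 2 + ‖β‖ ^ 2 = 1)
    {p q : ℝ} (hp : p = H₀ 0 0 * H₁ 0 0) (hq : q = -(κ.re * (H₀ 0 1 * H₁ 0 1))) (hp0 : p ≠ 0)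
    (ξ k : ℝ) (hk : Real.sin (2 * k - s) ≠ 0) :
    Tendsto (fun t : ℕ => momentumOverlap (twoPeriodCoin H₀ H₁) α β t k (ξ / t)) atTop
      (𝓝 (Real.cos (ξ * groupVelocity p q (2 * k - s)) -
        Real.sin (ξ * groupVelocity p q (2 * k - s)) * (star ![α, β] ⬝ᵥ
          spinVector (twoStepDiag (H₀ 0 0) (H₀ 0 1) (H₁ 0 0) (H₁ 0 1) κ (2 * k - s))
            (twoStepOff (H₀ 0 0) (H₀ 0 1) (H₁ 0 0) (H₁ 0 1) κ (2 * k - s))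
            ![α, β] (dispersion p q (2 * k - s))))) := by
  obtain ⟨h₀, hd₀, -, -⟩ := orthogonal_fin_two hH₀
  obtain ⟨h₁, -, -, -⟩ := orthogonal_fin_two hH₁
  have hκ1 : ‖κ‖ = 1 := by
    rw [hκ, norm_mul, ← neg_mul, ← Complex.ofReal_neg, Complex.norm_exp_ofReal_mul_I, mul_one,
      Complex.norm_real, Real.norm_eq_abs]
    exact (pow_eq_one_iff_of_nonneg (abs_nonneg _) two_ne_zero).1 (by rw [sq_abs, hd₀])
  have hpq : |p| + |q| ≤ 1 := hp ▸ hq ▸ abs_add_abs_twoStep_le h₀ h₁ hκ1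
  have hφ : star ![α, β] ⬝ᵥ ![α, β] = 1 := by
    have := star_momentumAmplitude_dotProduct_self
      (twoPeriodCoin_mem_unitaryGroup hH₀ hH₁) hαβ 0 0
    exact this
  have hξ : Tendsto (fun t : ℕ => ξ / (t : ℝ)) atTop (𝓝 0) :=
    tendsto_const_div_atTop_nhds_zero_nat ξ
  have hmain := tendsto_overlap_pow (θ := dispersion p q)
    (continuous_twoStepDiag (H₀ 0 0) (H₀ 0 1) (H₁ 0 0) (H₁ 0 1) κ)
    (continuous_twoStepOff (H₀ 0 0) (H₀ 0 1) (H₁ 0 0) (H₁ 0 1) κ)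
    (norm_sq_twoStep h₀ h₁ hκ1)
    (fun u => by rw [cos_dispersion hpq, twoStepDiag_re, hp, hq])
    (hasDerivAt_dispersion hp0 hpq hk) (sin_dispersion_ne_zero hp0 hpq hk) hφ
    (δ := fun t : ℕ => 2 * (ξ / t)) (n := fun t : ℕ => t / 2) (l := atTop)
    (by simpa using hξ.const_mul 2) (tendsto_half_mul_two_div ξ)
  have heven : ∀ t : ℕ, momentumOverlap (twoPeriodCoin H₀ H₁) α β (2 * (t / 2)) k (ξ / t) =
      star ((quaternionMatrix
          (twoStepDiag (H₀ 0 0) (H₀ 0 1) (H₁ 0 0) (H₁ 0 1) κ (2 * k - s))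
          (twoStepOff (H₀ 0 0) (H₀ 0 1) (H₁ 0 0) (H₁ 0 1) κ (2 * k - s)) ^ (t / 2)).mulVec
            ![α, β]) ⬝ᵥ
        (quaternionMatrix
          (twoStepDiag (H₀ 0 0) (H₀ 0 1) (H₁ 0 0) (H₁ 0 1) κ (2 * k - s - 2 * (ξ / t)))
          (twoStepOff (H₀ 0 0) (H₀ 0 1) (H₁ 0 0) (H₁ 0 1) κ (2 * k - s - 2 * (ξ / t))) ^
            (t / 2)).mulVec ![α, β] := by
    intro t
    rw [momentumOverlap, momentumAmplitude_two_mul hH₀ hH₁ hs hκ,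
      momentumAmplitude_two_mul hH₀ hH₁ hs hκ, star_smul, smul_dotProduct, dotProduct_smul,
      smul_smul, Complex.star_def, Complex.conj_mul', norm_pow, Complex.norm_exp_ofReal_mul_I,
      show 2 * (k - ξ / t) - s = 2 * k - s - 2 * (ξ / t) by ring]
    simp
  have hdiff : Tendsto (fun t : ℕ => momentumOverlap (twoPeriodCoin H₀ H₁) α β t k (ξ / t) -
      momentumOverlap (twoPeriodCoin H₀ H₁) α β (2 * (t / 2)) k (ξ / t)) atTop (𝓝 0) := by
    refine squeeze_zero_norm (fun t => norm_momentumOverlap_sub_two_mul_half_le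
      (twoPeriodCoin_mem_unitaryGroup hH₀ hH₁) hαβ t k (ξ / t)) ?_
    simpa using hξ.abs.const_mul 2
  have := hdiff.add (hmain.congr fun t => (heven t).symm)
  simpa only [sub_add_cancel, zero_add] using this

/-- The even function of the velocity whose mean is the limiting characteristic function. -/
noncomputable def symmetrizedPhase (γ ξ y : ℝ) : ℂ :=
  Real.cos (ξ * y) - Complex.I * (γ * y * Real.sin (ξ * y))

lemma continuous_symmetrizedPhase (γ ξ : ℝ) : Continuous (symmetrizedPhase γ ξ) := by
  unfold symmetrizedPhase; fun_prop

lemma symmetrizedPhase_abs (γ ξ y : ℝ) : symmetrizedPhase γ ξ |y| = symmetrizedPhase γ ξ y := by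
  rcases abs_choice y with h | h <;> rw [h]
  simp [symmetrizedPhase]

lemma momentumAmplitude_add_two_pi (U : ℕ → Matrix (Fin 2) (Fin 2) ℂ) (α β : ℂ) (t : ℕ) (k : ℝ) :
    momentumAmplitude U α β t (k + 2 * Real.pi) = momentumAmplitude U α β t k := by
  have h : shiftMatrix (k + 2 * Real.pi) = shiftMatrix k := by
    have e1 : Complex.exp (((k + 2 * Real.pi : ℝ) : ℂ) * Complex.I) =
        Complex.exp (k * Complex.I) := by
      push_cast
      rw [add_mul]
      exact Complex.exp_periodic _
    unfold shiftMatrix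
    rw [Complex.exp_neg, Complex.exp_neg, e1]
  induction t with
  | zero => rfl
  | succ t ih => rw [momentumAmplitude, momentumAmplitude, h, ih]

lemma periodic_momentumOverlap (U : ℕ → Matrix (Fin 2) (Fin 2) ℂ) (α β : ℂ) (t : ℕ) (ε : ℝ) :
    Function.Periodic (fun k => momentumOverlap U α β t k ε) (2 * Real.pi) := by
  intro k
  simp only [momentumOverlap]
  rw [momentumAmplitude_add_two_pi, show k + 2 * Real.pi - ε = k - ε + 2 * Real.pi by ring,
    momentumAmplitude_add_two_pi]

lemma ae_sin_two_mul_sub_ne_zero (s : ℝ) : ∀ᵐ k : ℝ, Real.sin (2 * k - s) ≠ 0 := by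
  rw [ae_iff]
  refine Set.Countable.measure_zero
    ((Set.countable_range fun n : ℤ => (n * Real.pi + s) / 2).mono ?_) _
  intro k hk
  simp only [ne_eq, not_not, Set.mem_ofPred_eq, Real.sin_eq_zero_iff] at hk
  obtain ⟨n, hn⟩ := hk
  exact ⟨n, by simp only [hn]; ring⟩

lemma integral_reflect_of_periodic {F : ℝ → ℂ} (hF : Function.Periodic F (2 * Real.pi)) (s : ℝ) :
    ∫ k in 0..2 * Real.pi, F (s - k) = ∫ k in 0..2 * Real.pi, F k := by
  rw [intervalIntegral.integral_comp_sub_left, sub_zero]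
  have := hF.intervalIntegral_add_eq (s - 2 * Real.pi) 0
  simpa using this

lemma integral_two_mul_sub_of_periodic {F : ℝ → ℂ} (hF : Function.Periodic F (2 * Real.pi))
    (hint : ∀ a b, IntervalIntegrable F volume a b) (s : ℝ) :
    ∫ k in 0..2 * Real.pi, F (2 * k - s) = ∫ u in 0..2 * Real.pi, F u := by
  rw [intervalIntegral.integral_comp_mul_sub F two_ne_zero]
  have h1 := hF.intervalIntegral_add_eq (-s) 0
  have h2 := hF.intervalIntegral_add_eq (-s + 2 * Real.pi) 0
  have h3 := intervalIntegral.integral_add_adjacent_intervals (hint (-s) (-s + 2 * Real.pi))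
    (hint (-s + 2 * Real.pi) (-s + 2 * Real.pi + 2 * Real.pi))
  rw [h1, h2, zero_add] at h3
  rw [show 2 * 0 - s = -s by ring, show 2 * (2 * Real.pi) - s =
    -s + 2 * Real.pi + 2 * Real.pi by ring, ← h3, ← two_smul ℝ, smul_smul]
  norm_num

/-- The characteristic functions of the rescaled positions converge to the mean of
`symmetrizedPhase` under the Konno density. -/
lemma tendsto_charFun_positionLaw {H₀ H₁ : Matrix (Fin 2) (Fin 2) ℝ}
    (hH₀ : H₀ ∈ Matrix.orthogonalGroup (Fin 2) ℝ) (hH₁ : H₁ ∈ Matrix.orthogonalGroup (Fin 2) ℝ)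
    {s : ℝ} {κ : ℂ} (hs : Complex.exp (s * Complex.I) ^ 2 = H₀.det * H₁.det)
    (hκ : κ = H₀.det * Complex.exp (-(s * Complex.I))) {α β : ℂ} (hαβ : ‖α‖ ^ 2 + ‖β‖ ^ 2 = 1)
    {A B : ℝ} (hA : 0 < A) (hA1 : A < 1) (hAB : A ≤ B) (hB1 : B ≤ 1)
    (hp : |H₀ 0 0 * H₁ 0 0| = A * B)
    (hq : |κ.re * (H₀ 0 1 * H₁ 0 1)| = √(1 - A ^ 2) * √(1 - B ^ 2)) (ξ : ℝ) :
    Tendsto (fun t : ℕ => charFun ((positionLaw (twoPeriodCoin H₀ H₁) α β t).map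
        fun x : ℤ => (x : ℝ) / (t : ℝ)) ξ) atTop
      (𝓝 (∫ y, konnoDensity A y • symmetrizedPhase
        (‖α‖ ^ 2 - ‖β‖ ^ 2 + (α * conj β + conj α * β).re * H₀ 0 1 / H₀ 0 0) ξ y)) := by
  set γ := ‖α‖ ^ 2 - ‖β‖ ^ 2 + (α * conj β + conj α * β).re * H₀ 0 1 / H₀ 0 0 with hγ
  set p := H₀ 0 0 * H₁ 0 0 with hp_def
  set q := -(κ.re * (H₀ 0 1 * H₁ 0 1)) with hq_def
  have hp0 : p ≠ 0 := abs_pos.1 (hp ▸ mul_pos hA (hA.trans_le hAB))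
  have ha₀ : H₀ 0 0 ≠ 0 := left_ne_zero_of_mul hp0
  have hpq : |p| + |q| ≤ 1 := by
    rw [hp, hq_def, abs_neg, hq]
    have a2 : √(1 - A ^ 2) ^ 2 = 1 - A ^ 2 := Real.sq_sqrt (by nlinarith)
    have b2 : √(1 - B ^ 2) ^ 2 = 1 - B ^ 2 := Real.sq_sqrt (by nlinarith)
    nlinarith [sq_nonneg (A - B), sq_nonneg (√(1 - A ^ 2) - √(1 - B ^ 2))]
  have hU := twoPeriodCoin_mem_unitaryGroup hH₀ hH₁
  set F : ℕ → ℝ → ℂ := fun t k => momentumOverlap (twoPeriodCoin H₀ H₁) α β t k (ξ / t) with hF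
  have hFc : ∀ t, Continuous (F t) := fun t => continuous_momentumOverlap _ α β t _
  have hFp : ∀ t, Function.Periodic (F t) (2 * Real.pi) := fun t =>
    periodic_momentumOverlap _ α β t _
  have hFb : ∀ t k, ‖F t k‖ ≤ 2 := fun t k => norm_momentumOverlap_le hU hαβ t k _
  -- averaging over `u ↦ -u`, that is `k ↦ s - k`, removes the unbounded part of the limit
  have hsym : ∀ t, ∫ k in 0..2 * Real.pi, F t k =
      ∫ k in 0..2 * Real.pi, (2 : ℂ)⁻¹ * (F t k + F t (s - k)) := by
    intro t
    have hr : Continuous fun k => F t (s - k) := (hFc t).comp (by fun_prop)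
    rw [intervalIntegral.integral_const_mul, intervalIntegral.integral_add
      ((hFc t).intervalIntegrable _ _) (hr.intervalIntegrable _ _),
      integral_reflect_of_periodic (hFp t)]
    ring
  have hlim : Tendsto (fun t => ∫ k in 0..2 * Real.pi, (2 : ℂ)⁻¹ * (F t k + F t (s - k))) atTop
      (𝓝 (∫ k in 0..2 * Real.pi, symmetrizedPhase γ ξ (groupVelocity p q (2 * k - s)))) := by
    refine intervalIntegral.tendsto_integral_filter_of_dominated_convergence (fun _ => 2)
      (Eventually.of_forall fun t => ?_) (Eventually.of_forall fun t => ?_) (by simp) ?_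
    · have hr : Continuous fun k => F t (s - k) := (hFc t).comp (by fun_prop)
      exact (((hFc t).add hr).const_mul (2 : ℂ)⁻¹).aestronglyMeasurable
    · refine Eventually.of_forall fun k _ => ?_
      rw [norm_mul, norm_inv, Complex.norm_ofNat]
      have := (norm_add_le (F t k) (F t (s - k))).trans (add_le_add (hFb _ _) (hFb _ _))
      linarith
    · filter_upwards [ae_sin_two_mul_sub_ne_zero s] with k hk _
      have hk' : Real.sin (2 * (s - k) - s) ≠ 0 := by
        rw [show 2 * (s - k) - s = -(2 * k - s) by ring, Real.sin_neg]
        exact neg_ne_zero.2 hk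
      have h1 := tendsto_momentumOverlap hH₀ hH₁ hs hκ hαβ hp_def hq_def hp0 ξ k hk
      have h2 := tendsto_momentumOverlap hH₀ hH₁ hs hκ hαβ hp_def hq_def hp0 ξ (s - k) hk'
      rw [show 2 * (s - k) - s = -(2 * k - s) by ring] at h2
      have h3 := (h1.add h2).const_mul (2 : ℂ)⁻¹
      convert! h3 using 2
      have hspin := spin_sub_spin_neg (b₀ := H₀ 0 1) (b₁ := H₁ 0 1) (κ := κ) ha₀ α β (2 * k - s)
        (q := q) hp_def
      rw [← hγ] at hspin
      rw [groupVelocity_neg, mul_neg, Real.cos_neg, Real.sin_neg, symmetrizedPhase,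
        Complex.ofReal_neg]
      linear_combination (2 : ℂ)⁻¹ *
        (Real.sin (ξ * groupVelocity p q (2 * k - s)) : ℂ) * hspin
  have hvel : ∫ k in 0..2 * Real.pi, symmetrizedPhase γ ξ (groupVelocity p q (2 * k - s)) =
      2 * Real.pi * ∫ y, konnoDensity A y • symmetrizedPhase γ ξ y := by
    have hper : Function.Periodic (fun u => symmetrizedPhase γ ξ (groupVelocity p q u))
        (2 * Real.pi) := by
      intro u
      simp only [groupVelocity, Real.sin_add_two_pi, Real.cos_add_two_pi]
    rw [integral_two_mul_sub_of_periodic hper fun a b =>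
      intervalIntegrable_comp_groupVelocity hpq (continuous_symmetrizedPhase γ ξ) a b]
    have := integral_abs_groupVelocity hA hA1 hAB hB1 hp (by rw [hq_def, abs_neg, hq]) hpq
      (continuous_symmetrizedPhase γ ξ)
    simpa only [symmetrizedPhase_abs] using this
  have hπ : (2 * Real.pi : ℂ) ≠ 0 := by simp [Real.pi_ne_zero]
  simp_rw [charFun_map_positionLaw]
  have := hlim.const_mul (2 * Real.pi : ℂ)⁻¹
  rw [hvel, inv_mul_cancel_left₀ hπ] at this
  exact this.congr fun t => by rw [← hsym t]

/-! ### The limit law -/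

lemma integrable_konnoDensity {A : ℝ} (hA : 0 < A) (hA1 : A < 1) : Integrable (konnoDensity A) := by
  refine ⟨(measurable_konnoDensity A).aestronglyMeasurable, ?_⟩
  rw [hasFiniteIntegral_iff_ofReal
    (Eventually.of_forall (konnoDensity_nonneg (by rwa [abs_of_pos hA]))),
    lintegral_konnoDensity hA hA1]
  exact ENNReal.one_lt_top

/-- Against the tilted Konno density, only the even part of `e^{iξy}(1 - γy)` contributes. -/
lemma integral_konnoDensity_mul_exp {A : ℝ} (hA : 0 < A) (hA1 : A < 1) (γ ξ : ℝ) :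
    ∫ y, (konnoDensity A y * (1 - γ * y)) • Complex.exp (ξ * y * Complex.I) =
      ∫ y, konnoDensity A y • symmetrizedPhase γ ξ y := by
  set J : ℝ → ℂ := fun y => (konnoDensity A y * (1 - γ * y)) • Complex.exp (ξ * y * Complex.I)
    with hJ
  have hnn := konnoDensity_nonneg (a := A) (by rwa [abs_of_pos hA])
  have hint : Integrable J := by
    refine ((integrable_konnoDensity hA hA1).mul_const (1 + |γ|)).mono' ?_
      (Eventually.of_forall fun y => ?_)
    · have := measurable_konnoDensity A
      exact Measurable.aestronglyMeasurable (by fun_prop)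
    · rw [hJ, norm_smul, ← Complex.ofReal_mul, Complex.norm_exp_ofReal_mul_I, mul_one, norm_mul,
        Real.norm_of_nonneg (hnn y)]
      by_cases hy : y ∈ Set.Ioo (-|A|) |A|
      · refine mul_le_mul_of_nonneg_left ?_ (hnn y)
        rw [abs_of_pos hA] at hy
        have hy1 : |y| ≤ 1 := (abs_lt.2 hy).le.trans hA1.le
        refine (norm_sub_le _ _).trans ?_
        rw [norm_one, norm_mul, Real.norm_eq_abs, Real.norm_eq_abs]
        linarith [mul_le_of_le_one_right (abs_nonneg γ) hy1]
      · rw [konnoDensity_of_notMem hy]; simp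
  have hneg : ∫ y, J (-y) = ∫ y, J y := integral_neg_eq_self J volume
  have h2 : ∫ y, J y = ∫ y, (2 : ℂ)⁻¹ * (J y + J (-y)) := by
    rw [integral_const_mul, integral_add hint hint.comp_neg, hneg]; ring
  rw [h2]
  refine integral_congr_ae (Eventually.of_forall fun y => ?_)
  simp only [hJ, konnoDensity_neg, symmetrizedPhase, Complex.real_smul]
  have e1 : Complex.exp (ξ * y * Complex.I) =
      Real.cos (ξ * y) + Real.sin (ξ * y) * Complex.I := by
    rw [Complex.exp_mul_I]; push_cast; ring
  have e2 : Complex.exp (ξ * (-y : ℝ) * Complex.I) =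
      Real.cos (ξ * y) - Real.sin (ξ * y) * Complex.I := by
    rw [Complex.exp_mul_I]; push_cast; rw [mul_neg, Complex.cos_neg, Complex.sin_neg]; ring
  rw [e1, e2]
  simp only [Complex.ofReal_mul, Complex.ofReal_sub, Complex.ofReal_one, Complex.ofReal_neg]
  ring

lemma limitDensity_eq (a a₀ b₀ : ℝ) (α β : ℂ) (x : ℝ) :
    limitDensity a a₀ b₀ α β x = konnoDensity |a| x *
      (1 - (‖α‖ ^ 2 - ‖β‖ ^ 2 + (α * conj β + conj α * β).re * b₀ / a₀) * x) := by
  rw [limitDensity, konnoDensity_abs]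

lemma measurable_limitDensity (a a₀ b₀ : ℝ) (α β : ℂ) : Measurable (limitDensity a a₀ b₀ α β) := by
  have := measurable_konnoDensity a
  unfold limitDensity
  fun_prop

/-- The tilt is at most `1 / |a₀|`, by Cauchy-Schwarz for the Bloch vector of `(α, β)`. -/
lemma abs_tilt_mul_le {a₀ b₀ : ℝ} (h₀ : a₀ ^ 2 + b₀ ^ 2 = 1) (ha₀ : a₀ ≠ 0) {α β : ℂ}
    (hαβ : ‖α‖ ^ 2 + ‖β‖ ^ 2 = 1) :
    |‖α‖ ^ 2 - ‖β‖ ^ 2 + (α * conj β + conj α * β).re * b₀ / a₀| * |a₀| ≤ 1 := by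
  rw [← abs_mul, ← sq_le_one_iff_abs_le_one, add_mul, div_mul_cancel₀ _ ha₀]
  set r := (α * conj β + conj α * β).re with hr
  set m := ‖α‖ ^ 2 - ‖β‖ ^ 2 with hm
  have hbloch : m ^ 2 + r ^ 2 ≤ 1 := by
    have e : r ^ 2 ≤ 4 * (‖α‖ ^ 2 * ‖β‖ ^ 2) := by
      simp only [hr, Complex.sq_norm, Complex.normSq_apply, Complex.add_re, Complex.mul_re,
        Complex.conj_re, Complex.conj_im]
      nlinarith [sq_nonneg (α.re * β.im - α.im * β.re)]
    have : m ^ 2 + 4 * (‖α‖ ^ 2 * ‖β‖ ^ 2) = (‖α‖ ^ 2 + ‖β‖ ^ 2) ^ 2 := by rw [hm]; ring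
    rw [hαβ] at this
    linarith
  have : (m * a₀ + r * b₀) ^ 2 + (m * b₀ - r * a₀) ^ 2 = (m ^ 2 + r ^ 2) * (a₀ ^ 2 + b₀ ^ 2) := by
    ring
  rw [h₀, mul_one] at this
  nlinarith [sq_nonneg (m * b₀ - r * a₀)]

lemma limitDensity_nonneg {a a₀ b₀ : ℝ} (h₀ : a₀ ^ 2 + b₀ ^ 2 = 1) (ha₀ : a₀ ≠ 0) (ha : |a| < 1)
    (haa₀ : |a| ≤ |a₀|) {α β : ℂ} (hαβ : ‖α‖ ^ 2 + ‖β‖ ^ 2 = 1) (x : ℝ) :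
    0 ≤ limitDensity a a₀ b₀ α β x := by
  have hb := abs_tilt_mul_le h₀ ha₀ hαβ
  unfold limitDensity
  set γ := ‖α‖ ^ 2 - ‖β‖ ^ 2 + (α * conj β + conj α * β).re * b₀ / a₀
  by_cases hx : x ∈ Set.Ioo (-|a|) |a|
  · refine mul_nonneg (konnoDensity_nonneg ha x) ?_
    have : γ * x ≤ 1 := by
      refine (le_abs_self _).trans ?_
      rw [abs_mul]
      exact (mul_le_mul_of_nonneg_left ((abs_lt.2 hx).le.trans haa₀) (abs_nonneg γ)).trans hb
    linarith
  · rw [konnoDensity_of_notMem hx, zero_mul]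

lemma isProbabilityMeasure_limitDensity {a a₀ b₀ : ℝ} (h₀ : a₀ ^ 2 + b₀ ^ 2 = 1) (ha₀ : a₀ ≠ 0)
    (ha0 : a ≠ 0) (ha : |a| < 1) (haa₀ : |a| ≤ |a₀|) {α β : ℂ} (hαβ : ‖α‖ ^ 2 + ‖β‖ ^ 2 = 1) :
    IsProbabilityMeasure
      (volume.withDensity fun x => ENNReal.ofReal (limitDensity a a₀ b₀ α β x)) := by
  have hnn := limitDensity_nonneg h₀ ha₀ ha haa₀ hαβ
  have hA : 0 < |a| := abs_pos.2 ha0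
  set γ := ‖α‖ ^ 2 - ‖β‖ ^ 2 + (α * conj β + conj α * β).re * b₀ / a₀ with hγ
  have hk1 : ∫ y, konnoDensity |a| y = 1 := by
    rw [integral_eq_lintegral_of_nonneg_ae
      (Eventually.of_forall (konnoDensity_nonneg (by rwa [abs_abs])))
      (measurable_konnoDensity _).aestronglyMeasurable, lintegral_konnoDensity hA ha,
      ENNReal.toReal_one]
  have hint := integral_konnoDensity_mul_exp hA ha γ 0
  simp only [Complex.ofReal_zero, zero_mul, Complex.exp_zero, symmetrizedPhase, Real.cos_zero,
    Real.sin_zero, Complex.ofReal_one, mul_zero, sub_zero, Complex.real_smul, mul_one]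
    at hint
  rw [hγ] at hint
  simp only [← limitDensity_eq] at hint
  rw [integral_complex_ofReal, integral_complex_ofReal, hk1, Complex.ofReal_inj] at hint
  refine ⟨?_⟩
  rw [withDensity_apply _ MeasurableSet.univ, Measure.restrict_univ,
    ← ofReal_integral_eq_lintegral_ofReal ?_ (Eventually.of_forall hnn), hint, ENNReal.ofReal_one]
  by_contra h
  rw [integral_undef h] at hint
  exact zero_ne_one hint

/-- The limit theorem for both signs of the determinant at once, the dispersion relation being
described by the parameters `|a| ≤ B`. -/
lemma rescaledHasLimitDensity_of_params {H₀ H₁ : Matrix (Fin 2) (Fin 2) ℝ}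
    (hH₀ : H₀ ∈ Matrix.orthogonalGroup (Fin 2) ℝ) (hH₁ : H₁ ∈ Matrix.orthogonalGroup (Fin 2) ℝ)
    {s : ℝ} {κ : ℂ} (hs : Complex.exp (s * Complex.I) ^ 2 = H₀.det * H₁.det)
    (hκ : κ = H₀.det * Complex.exp (-(s * Complex.I))) {α β : ℂ} (hαβ : ‖α‖ ^ 2 + ‖β‖ ^ 2 = 1)
    {a B : ℝ} (ha0 : a ≠ 0) (ha1 : |a| < 1) (haB : |a| ≤ B) (hB1 : B ≤ 1)
    (hp : |H₀ 0 0 * H₁ 0 0| = |a| * B)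
    (hq : |κ.re * (H₀ 0 1 * H₁ 0 1)| = √(1 - |a| ^ 2) * √(1 - B ^ 2))
    (haa₀ : |a| ≤ |H₀ 0 0|) :
    RescaledHasLimitDensity (positionLaw (twoPeriodCoin H₀ H₁) α β)
      (limitDensity a (H₀ 0 0) (H₀ 0 1) α β) := by
  have hA : 0 < |a| := abs_pos.2 ha0
  have ha₀ : H₀ 0 0 ≠ 0 := abs_pos.1 (hA.trans_le haa₀)
  have h₀ := (orthogonal_fin_two hH₀).1
  have hnn := limitDensity_nonneg h₀ ha₀ ha1 haa₀ hαβ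
  have hm := measurable_limitDensity a (H₀ 0 0) (H₀ 0 1) α β
  have hP := isProbabilityMeasure_positionLaw (twoPeriodCoin_mem_unitaryGroup hH₀ hH₁) hαβ
  have hQ := isProbabilityMeasure_limitDensity h₀ ha₀ ha0 ha1 haa₀ hαβ
  refine ⟨hm, hnn, hP, hQ, fun t => by fun_prop, by fun_prop, ?_⟩
  refine ProbabilityMeasure.tendsto_iff_tendsto_charFun.2 fun ξ => ?_
  have hlim := tendsto_charFun_positionLaw hH₀ hH₁ hs hκ hαβ hA ha1 haB hB1 hp hq ξ
  convert! hlim using 2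
  rw [← integral_konnoDensity_mul_exp hA ha1]
  simp only [ProbabilityMeasure.coe_mk, Measure.map_id', charFun_apply_real, ← limitDensity_eq]
  rw [integral_withDensity_eq_integral_toReal_smul hm.ennreal_ofReal (by simp)]
  refine integral_congr_ae (Eventually.of_forall fun y => ?_)
  simp only [ENNReal.toReal_ofReal (hnn y)]

theorem theorem1 (H₀ H₁ : Matrix (Fin 2) (Fin 2) ℝ)
    (hH₀ : H₀ ∈ Matrix.orthogonalGroup (Fin 2) ℝ) (hH₁ : H₁ ∈ Matrix.orthogonalGroup (Fin 2) ℝ)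
    (hne₀ : ∀ i j, H₀ i j ≠ 0) (hne₁ : ∀ i j, H₁ i j ≠ 0)
    (α β : ℂ) (hαβ : ‖α‖ ^ 2 + ‖β‖ ^ 2 = 1) :
    (0 < (H₁ * H₀).det →
      ∀ a : ℝ, (a = H₀ 0 0 ∨ a = H₁ 0 0) → |a| = min |H₀ 0 0| |H₁ 0 0| →
        RescaledHasLimitDensity (positionLaw (twoPeriodCoin H₀ H₁) α β)
          (limitDensity a (H₀ 0 0) (H₀ 0 1) α β)) ∧
    ((H₁ * H₀).det < 0 →
      RescaledHasLimitDensity (positionLaw (twoPeriodCoin H₀ H₁) α β)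
        (limitDensity (H₀ 0 0 * H₁ 0 0) (H₀ 0 0) (H₀ 0 1) α β)) := by
  obtain ⟨h₀, hd₀, -, -⟩ := orthogonal_fin_two hH₀
  obtain ⟨h₁, hd₁, -, -⟩ := orthogonal_fin_two hH₁
  have hlt : ∀ {a b : ℝ}, a ^ 2 + b ^ 2 = 1 → b ≠ 0 → |a| < 1 := fun {a b} h hb => by
    rw [← sq_lt_one_iff_abs_lt_one]
    have : 0 < b ^ 2 := by positivity
    linarith
  have hsqrt : ∀ {a b : ℝ}, a ^ 2 + b ^ 2 = 1 → √(1 - |a| ^ 2) = |b| := fun {a b} h => by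
    rw [sq_abs, ← Real.sqrt_sq_eq_abs]
    congr 1
    linarith
  have ha₀ := hlt h₀ (hne₀ 0 1)
  have ha₁ := hlt h₁ (hne₁ 0 1)
  have hprod : (H₀.det * H₁.det) ^ 2 = 1 := by rw [mul_pow, hd₀, hd₁, one_mul]
  rw [Matrix.det_mul, mul_comm H₁.det]
  constructor
  · intro hpos a ha hmin
    have hdet : H₀.det * H₁.det = 1 := (pow_eq_one_iff_of_nonneg hpos.le two_ne_zero).1 hprod
    have hd : |H₀.det| = 1 := by
      rw [← Real.sqrt_sq_eq_abs, hd₀, Real.sqrt_one]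
    have ha0 : a ≠ 0 := by rcases ha with rfl | rfl <;> [exact hne₀ 0 0; exact hne₁ 0 0]
    have hs : Complex.exp ((0 : ℝ) * Complex.I) ^ 2 = H₀.det * H₁.det := by
      rw [← Complex.ofReal_mul, hdet]; simp
    refine rescaledHasLimitDensity_of_params hH₀ hH₁ (s := 0) (κ := H₀.det)
      (B := max |H₀ 0 0| |H₁ 0 0|) hs (by simp) hαβ ha0 ?_ ?_ ?_ ?_ ?_ ?_
    · exact hmin ▸ (min_le_left _ _).trans_lt ha₀
    · exact hmin ▸ min_le_max
    · exact max_le ha₀.le ha₁.le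
    · rw [hmin, min_mul_max, abs_mul]
    · rw [hmin, Complex.ofReal_re, abs_mul, hd, one_mul, abs_mul, ← hsqrt h₀, ← hsqrt h₁]
      rcases le_total |H₀ 0 0| |H₁ 0 0| with h | h
      · rw [min_eq_left h, max_eq_right h]
      · rw [min_eq_right h, max_eq_left h, mul_comm]
    · exact hmin ▸ min_le_left _ _
  · intro hneg
    have hdet : H₀.det * H₁.det = -1 := by
      have := (pow_eq_one_iff_of_nonneg (neg_nonneg.2 hneg.le) two_ne_zero).1
        ((neg_sq _).trans hprod)
      linarith
    have hs : Complex.exp ((Real.pi / 2 : ℝ) * Complex.I) ^ 2 = H₀.det * H₁.det := by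
      rw [← Complex.ofReal_mul, hdet]
      push_cast
      rw [Complex.exp_pi_div_two_mul_I, Complex.I_sq]
    have hle : |H₀ 0 0 * H₁ 0 0| ≤ |H₀ 0 0| := by
      rw [abs_mul]; exact mul_le_of_le_one_right (abs_nonneg _) ha₁.le
    have hlt1 := hle.trans_lt ha₀
    refine rescaledHasLimitDensity_of_params hH₀ hH₁ (s := Real.pi / 2) (B := 1) hs rfl hαβ
      (mul_ne_zero (hne₀ 0 0) (hne₁ 0 0)) hlt1 hlt1.le le_rfl (by rw [mul_one]) ?_ hle
    have : (H₀.det * Complex.exp (-((Real.pi / 2 : ℝ) * Complex.I)) : ℂ).re = 0 := by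
      rw [← neg_mul, ← Complex.ofReal_neg, Complex.re_ofReal_mul, Complex.exp_ofReal_mul_I_re,
        Real.cos_neg, Real.cos_pi_div_two, mul_zero]
    rw [this]
    simp
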